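/- Let $n\in\mathbb N$. For a symmetric positive definite $A\in\mathbb{R}^{n\times n}$ let $\mu_A$ be the Gaussian measure $d\mu_A(x)=\frac{\sqrt{\det A}}{(2\pi)^{n/2}}e^{-\frac12x^\intercal Ax}\,dx$ on $\mathbb{R}^n$, and for symmetric positive definite $B$ let $d\nu_{A,B}=f_{A,B}\,d\mu_A$ with $f_{A,B}(x)=c_0e^{-\frac12x^\intercal Bx}$ and $c_0=\left(\int e^{-\frac12y^\intercal By}d\mu_A(y)\right)^{-1}$. For a density $f$ and $t\ge0$ put (Mehler formula) $P^A_tf(x)=\int f\left(e^{-tA}x+\sqrt{\mathrm{Id}-e^{-2tA}}\,y\right)d\mu_A(y)$ and $w_t=-\nabla\log P^A_tf$. A *Kim–Milman map* from $\mu_A$ to $f\mu_A$ is a map $T:\mathbb{R}^n\to\mathbb{R}^n$ for which there are a locally Lipschitz family of diffeomorphisms $(S_t)_{t\ge0}$ of $\mathbb{R}^n$ with $\frac{d}{dt}S_t(x)=w_t(S_t(x))$, $S_0(x)=x$, and times $t_k\to\infty$ such that $S_{t_k}^{-1}\to T$ uniformly on compact sets. A *Brenier map* from $\mu$ to $\nu$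 is a measurable map that pushes $\mu$ forward to $\nu$ and equals $\mu$-almost everywhere the gradient of a convex function $\varphi:\mathbb{R}^n\to\mathbb{R}$. 1. For all symmetric positive definite $A,B\in\mathbb{R}^{n\times n}$ there is exactly one Kim–Milman map from $\mu_A$ to $\nu_{A,B}$; it is $1$-Lipschitz and pushes $\mu_A$ forward to $\nu_{A,B}$; and there is a Brenier map from $\mu_A$ to $\nu_{A,B}$. 2. For all symmetric positive definite $A,B$ with $AB\ne BA$ there are $t\ge0$ and a symmetric positive definite $B'$ with $AB'\ne B'A$ and $P^A_tf_{A,B}=f_{A,B'}$, such that the Kim–Milman map from $\mu_A$ to $\nu_{A,B'}$ does not coincide $\mu_A$-almost everywhere with any Brenier map from $\mu_A$ to $\nu_{A,B'}$. 3. In particular, if $n\ge2$, there are symmetric positive definite $A,B\in\mathbb{R}^{n\times n}$ with $AB\neq BA$ for which the Kim–Milman map from $\mu_A$ to $\nu_{A,B}$ does not coincide $\mu_A$-almost everywhere with any Brenier map from $\mu_A$ to $\nu_{A,B}$. Thus the Kim–Milman map is in general different from the Brenier map. -/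

import Mathlib

open MeasureTheory Filter Topology
open scoped MatrixOrder ContDiff

noncomputable section

namespace KimMilman

/-- `ℝⁿ` with its Euclidean structure and Lebesgue measure. -/
abbrev Space (n : ℕ) : Type := EuclideanSpace ℝ (Fin n)

variable {n : ℕ}

/-- The product `M x` of a matrix and a vector of `ℝⁿ`. -/
def app (M : Matrix (Fin n) (Fin n) ℝ) (x : Space n) : Space n :=
  Matrix.toEuclideanCLM (𝕜 := ℝ) M x

/-- The quadratic form `xᵀ M x`. -/
def quad (M : Matrix (Fin n) (Fin n) ℝ) (x : Space n) : ℝ :=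
  inner ℝ x (app M x)

/-- The centred Gaussian measure with precision matrix `A`. -/
def gaussian (A : Matrix (Fin n) (Fin n) ℝ) : Measure (Space n) :=
  volume.withDensity fun x =>
    ENNReal.ofReal (√A.det / (2 * Real.pi) ^ ((n : ℝ) / 2) * Real.exp (-(1 / 2) * quad A x))

/-- The density `c₀ exp (-½ xᵀ B x)` with respect to `gaussian A`, where `c₀` normalizes the
total mass to `1`. -/
def tiltDensity (A B : Matrix (Fin n) (Fin n) ℝ) (x : Space n) : ℝ :=
  (∫ y, Real.exp (-(1 / 2) * quad B y) ∂(gaussian A))⁻¹ * Real.exp (-(1 / 2) * quad B x)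

/-- The measure with density `f` with respect to `gaussian A`. -/
def target (A : Matrix (Fin n) (Fin n) ℝ) (f : Space n → ℝ) : Measure (Space n) :=
  (gaussian A).withDensity fun x => ENNReal.ofReal (f x)

/-- The semigroup `P_t^A` generated by `L = Δ - A x · ∇`, given by the Mehler formula
`P_t^A f (x) = ∫ f (e^{-tA} x + √(Id - e^{-2tA}) y) dμ(y)` with `μ = gaussian A`.
Here `CFC.sqrt` is the positive semidefinite square root of a positive semidefinite matrix. -/
def heatFlow (A : Matrix (Fin n) (Fin n) ℝ) (t : ℝ) (f : Space n → ℝ) (x : Space n) : ℝ :=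
  ∫ y, f (app (NormedSpace.exp (-t • A)) x
    + app (CFC.sqrt (1 - NormedSpace.exp (-(2 * t) • A))) y) ∂(gaussian A)

/-- The velocity field `w_t = -∇ log P_t^A f`. -/
def velocity (A : Matrix (Fin n) (Fin n) ℝ) (f : Space n → ℝ) (t : ℝ) (x : Space n) : Space n :=
  -gradient (fun z => Real.log (heatFlow A t f z)) x

/-- `S` is a locally Lipschitz family of diffeomorphisms `S_t`, `t ≥ 0`, with inverses `R_t`,
which solves `d/dt S_t(x) = w_t(S_t(x))`, `S_0(x) = x` (one-sided derivative at `t = 0`).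
Values at negative times are irrelevant. -/
structure IsFlow (w : ℝ → Space n → Space n) (S R : ℝ → Space n → Space n) : Prop where
  init : ∀ x, S 0 x = x
  ode : ∀ x, ∀ t, 0 ≤ t → HasDerivWithinAt (fun s => S s x) (w t (S t x)) (Set.Ici 0) t
  left_inv : ∀ t, 0 ≤ t → Function.LeftInverse (R t) (S t)
  right_inv : ∀ t, 0 ≤ t → Function.RightInverse (R t) (S t)
  smooth : ∀ t, 0 ≤ t → ContDiff ℝ ∞ (S t)
  smooth_inv : ∀ t, 0 ≤ t → ContDiff ℝ ∞ (R t)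
  locallyLipschitz :
    LocallyLipschitzOn (Set.Ici (0 : ℝ) ×ˢ Set.univ) fun p : ℝ × Space n => S p.1 p.2

/-- `T` is a Kim–Milman (heat-flow) map from `μ = gaussian A` to the measure with density `f`
with respect to `μ`: a limit, uniform on compact sets and along some sequence of times tending to
infinity, of the inverses of the flow of `w_t = -∇ log P_t^A f`. -/
def IsKimMilmanMap (A : Matrix (Fin n) (Fin n) ℝ) (f : Space n → ℝ) (T : Space n → Space n) :
    Prop :=
  ∃ S R : ℝ → Space n → Space n, IsFlow (velocity A f) S R ∧
    ∃ τ : ℕ → ℝ, Tendsto τ atTop atTop ∧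
      ∀ K : Set (Space n), IsCompact K → TendstoUniformlyOn (fun k => R (τ k)) T atTop K

/-- `T` is (a representative of) the Brenier map from `μ` to `ν`: it pushes `μ` forward to `ν`
and is `μ`-almost everywhere the gradient of a convex function. -/
structure IsBrenierMap (μ ν : Measure (Space n)) (T : Space n → Space n) : Prop where
  transport : MeasurePreserving T μ ν
  gradient_convex : ∃ φ : Space n → ℝ, ConvexOn ℝ Set.univ φ ∧ ∀ᵐ x ∂μ, HasGradientAt φ (T x) x

/-- Pairs `(A, B)` of symmetric positive definite matrices that do not commute. -/
def NonCommutingPair (A B : Matrix (Fin n) (Fin n) ℝ) : Prop :=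
  A.PosDef ∧ B.PosDef ∧ A * B ≠ B * A

/-- Every Kim–Milman map from `gaussian A` to the measure with density `tiltDensity A B` differs,
on a set of positive measure, from every Brenier map between the same measures. -/
def MapsDiffer (A B : Matrix (Fin n) (Fin n) ℝ) : Prop :=
  ∀ T T' : Space n → Space n, IsKimMilmanMap A (tiltDensity A B) T →
    IsBrenierMap (gaussian A) (target A (tiltDensity A B)) T' → ¬ T =ᵐ[gaussian A] T'

end KimMilman

end

/-!
Along the heat flow the tilted densities stay tilted: `P_t f_{A,B} = f_{A,B_t}`, where
`B_t⁻¹ = e^{tA} (B⁻¹ + σ_t A⁻¹ σ_t) e^{tA}` and `σ_t = √(1 - e^{-2tA})`. Hence `w_t(x) = B_t x`, the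
flow is given by the propagator `Φ_t` of the linear equation `Φ' = B_t Φ`, and the Kim–Milman map is
the linear map `T = lim Φ_t⁻¹`. The limit exists because `B_t` decays exponentially; `‖T‖ ≤ 1`
because `B_t` is positive; and `Φ_t⁻¹ (A + B_t)⁻¹ Φ_t⁻ᵀ` does not depend on `t`, so that
`T A⁻¹ Tᵀ = (A + B)⁻¹`, which is the transport property.

A linear Brenier map is symmetric. The map from `μ_A` to `ν_{A,B_s}` is `Φ_s T`, by restarting the
flow at time `s`; if it were a Brenier map for every `s ≥ 0`, then `Φ_s T` would be symmetric for
all `s`, and so would be its derivative `B T` at `s = 0`. Then `T` is symmetric and commutes with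
`B`, and `T (A + B) T = A` gives `T [A, B] T = [A, B]`. As `T (A + B) T = A` also forces `‖T‖ < 1`,
the commutator `[A, B]` vanishes.
-/

noncomputable section

namespace KimMilman

open scoped Matrix Matrix.Norms.L2Operator

section MatrixAlgebra

variable {m : Type*} [Fintype m]

section DecidableEq

variable [DecidableEq m]

lemma isUnit_det_of_posDef {M : Matrix m m ℝ} (hM : M.PosDef) : IsUnit M.det :=
  hM.det_pos.ne'.isUnit

lemma posDef_mul_mul_conjTranspose {M L : Matrix m m ℝ} (hM : M.PosDef) (hL : IsUnit L) :
    (L * M * Lᴴ).PosDef :=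
  hM.mul_mul_conjTranspose_same (Matrix.vecMul_injective_of_isUnit hL)

lemma commute_inv_right {R : Type*} [CommRing R] {M N : Matrix m m R} (h : Commute N M) :
    Commute N M⁻¹ := by
  simpa using Matrix.Commute.zpow_right h (-1)

lemma det_add_mul_mul {R : Type*} [CommRing R] {A B : Matrix m m R} (hA : IsUnit A.det)
    (hB : IsUnit B.det) (U V : Matrix m m R) :
    (A + U * B * V).det = A.det * B.det * (B⁻¹ + V * A⁻¹ * U).det := by
  have hBV : 1 + B * V * A⁻¹ * U = B * (B⁻¹ + V * A⁻¹ * U) := by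
    rw [mul_add, Matrix.mul_nonsing_inv _ hB]
    simp only [mul_assoc]
  rw [mul_assoc U, Matrix.det_add_mul _ _ hA, hBV, Matrix.det_mul,
    mul_assoc A.det]

lemma mul_mul_eq_of_mul_inv_mul_eq_inv {R : Type*} [CommRing R] {A B L N : Matrix m m R}
    (hA : IsUnit A.det) (hB : IsUnit B.det) (h : L * A⁻¹ * N = B⁻¹) : N * B * L = A := by
  have hright : L * (A⁻¹ * N * B) = 1 := by
    rw [← mul_assoc, ← mul_assoc, h, Matrix.nonsing_inv_mul _ hB]
  have hinv : A⁻¹ * (N * B * L) = 1 := by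
    simpa only [mul_assoc] using mul_eq_one_comm.1 hright
  rw [← Matrix.inv_eq_right_inv hinv, Matrix.nonsing_inv_nonsing_inv _ hA]

end DecidableEq

/-- The matrix `L` is the geometric mean of `P⁻¹` and `Q`. -/
theorem exists_posSemidef_mul_mul_eq {P Q : Matrix m m ℝ} (hP : P.PosDef) (hQ : Q.PosSemidef) :
    ∃ L : Matrix m m ℝ, L.PosSemidef ∧ L * P * L = Q := by
  classical
  set σ := CFC.sqrt P
  have hσ : σᴴ = σ := IsSelfAdjoint.of_nonneg (CFC.sqrt_nonneg P)
  have hσσ : σ * σ = P := CFC.sqrt_mul_sqrt_self P hP.posSemidef.nonneg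
  have hσu : IsUnit σ.det := by
    have := isUnit_det_of_posDef hP
    rw [← hσσ, Matrix.det_mul] at this
    exact isUnit_of_mul_isUnit_left this
  set κ := CFC.sqrt (σ * Q * σ)
  have hκκ : κ * κ = σ * Q * σ := by
    refine CFC.sqrt_mul_sqrt_self _ (Matrix.nonneg_iff_posSemidef.2 ?_)
    simpa only [hσ] using hQ.mul_mul_conjTranspose_same σ
  refine ⟨σ⁻¹ * κ * σ⁻¹, ?_, ?_⟩
  · have hκ : κ.PosSemidef := Matrix.nonneg_iff_posSemidef.1 (CFC.sqrt_nonneg _)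
    simpa only [Matrix.conjTranspose_nonsing_inv, hσ] using hκ.mul_mul_conjTranspose_same σ⁻¹
  · calc σ⁻¹ * κ * σ⁻¹ * P * (σ⁻¹ * κ * σ⁻¹)
        = σ⁻¹ * κ * (σ⁻¹ * σ) * (σ * σ⁻¹) * κ * σ⁻¹ := by simp only [← hσσ, mul_assoc]
      _ = σ⁻¹ * (κ * κ) * σ⁻¹ := by
        rw [Matrix.nonsing_inv_mul _ hσu, Matrix.mul_nonsing_inv _ hσu, mul_one, mul_one,
          mul_assoc σ⁻¹ κ κ]
      _ = (σ⁻¹ * σ) * Q * (σ * σ⁻¹) := by simp only [hκκ, mul_assoc]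
      _ = Q := by
        rw [Matrix.nonsing_inv_mul _ hσu, Matrix.mul_nonsing_inv _ hσu, one_mul, mul_one]

end MatrixAlgebra

section LinearODE

variable {E : Type*} [NormedAddCommGroup E] [NormedSpace ℝ E] {F : ℝ → E →L[ℝ] E}

/-- The terms of the Dyson series of the linear equation `x' = F x` with initial value `x₀`: the
Picard iterates started at `x₀` are its partial sums. -/
def dyson (F : ℝ → E →L[ℝ] E) (x₀ : E) : ℕ → ℝ → E
  | 0 => fun _ => x₀
  | k + 1 => fun t => ∫ s in (0 : ℝ)..t, F s (dyson F x₀ k s)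

lemma dyson_succ_zero (F : ℝ → E →L[ℝ] E) (x₀ : E) (k : ℕ) : dyson F x₀ (k + 1) 0 = 0 :=
  intervalIntegral.integral_same

lemma continuous_dyson (hF : Continuous F) (x₀ : E) (k : ℕ) : Continuous (dyson F x₀ k) := by
  induction k with
  | zero => exact continuous_const
  | succ k ih =>
    exact intervalIntegral.continuous_primitive
      (fun a b => (hF.clm_apply ih).intervalIntegrable a b) 0

lemma hasDerivAt_dyson_succ [CompleteSpace E] (hF : Continuous F) (x₀ : E) (k : ℕ) (t : ℝ) :
    HasDerivAt (dyson F x₀ (k + 1)) (F t (dyson F x₀ k t)) t :=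
  ((hF.clm_apply (continuous_dyson hF x₀ k)).integral_hasStrictDerivAt 0 t).hasDerivAt

lemma norm_dyson_le {K t : ℝ} (hK : ∀ s, |s| ≤ |t| → ‖F s‖ ≤ K) (x₀ : E) (k : ℕ) :
    ‖dyson F x₀ k t‖ ≤ ‖x₀‖ * ((K * |t|) ^ k / k.factorial) := by
  induction k generalizing t with
  | zero => simp [dyson]
  | succ k ih =>
    have hbound : ∀ s ∈ Set.uIoc 0 t, ‖F s (dyson F x₀ k s)‖
        ≤ ‖x₀‖ * K ^ (k + 1) / k.factorial * |s - 0| ^ k := fun s hs => by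
      have hst : |s| ≤ |t| := by
        simpa using Set.abs_sub_left_of_mem_uIcc (Set.uIoc_subset_uIcc hs)
      calc ‖F s (dyson F x₀ k s)‖ ≤ K * (‖x₀‖ * ((K * |s|) ^ k / k.factorial)) :=
            (F s).le_of_opNorm_le_of_le (hK s hst) (ih fun r hr => hK r (hr.trans hst))
        _ = _ := by rw [sub_zero, mul_pow]; ring
    calc ‖dyson F x₀ (k + 1) t‖
        ≤ ∫ s in Set.uIoc 0 t, ‖x₀‖ * K ^ (k + 1) / k.factorial * |s - 0| ^ k := by
          rw [dyson, intervalIntegral.norm_intervalIntegral_eq]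
          exact norm_integral_le_of_norm_le (Continuous.integrableOn_uIoc (by fun_prop))
            ((ae_restrict_mem measurableSet_uIoc).mono hbound)
      _ = ‖x₀‖ * ((K * |t|) ^ (k + 1) / (k + 1).factorial) := by
          rw [integral_const_mul, integral_pow_abs_sub_uIoc, Nat.factorial_succ, sub_zero, mul_pow]
          push_cast
          field_simp

lemma exists_norm_clm_le (hF : Continuous F) (r : ℝ) : ∃ K, ∀ s, |s| ≤ r → ‖F s‖ ≤ K := by
  obtain ⟨K, hK⟩ := (isCompact_Icc (a := -r) (b := r)).exists_bound_of_continuousOn hF.continuousOn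
  exact ⟨K, fun s hs => hK s (abs_le.1 hs)⟩

lemma summable_dyson [CompleteSpace E] (hF : Continuous F) (x₀ : E) (t : ℝ) :
    Summable fun k => dyson F x₀ k t := by
  obtain ⟨K, hK⟩ := exists_norm_clm_le hF |t|
  exact .of_norm_bounded ((Real.summable_pow_div_factorial (K * |t|)).mul_left ‖x₀‖)
    (norm_dyson_le hK x₀)

lemma hasDerivAt_tsum_dyson_succ [CompleteSpace E] (hF : Continuous F) (x₀ : E) (t : ℝ) :
    HasDerivAt (fun t => ∑' k, dyson F x₀ (k + 1) t) (∑' k, F t (dyson F x₀ k t)) t := by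
  set r := |t| + 1
  have hr : 0 < r := by positivity
  obtain ⟨K, hK⟩ := exists_norm_clm_le hF r
  have hK0 : 0 ≤ K := (norm_nonneg _).trans (hK 0 (by simpa using hr.le))
  have hbound : ∀ k, ∀ s ∈ Metric.ball (0 : ℝ) r, ‖F s (dyson F x₀ k s)‖
      ≤ K * (‖x₀‖ * ((K * r) ^ k / k.factorial)) := fun k s hs => by
    have hs' : |s| ≤ r := by simpa using (Metric.mem_ball.1 hs).le
    refine ((F s).le_of_opNorm_le_of_le (hK s hs')
      (norm_dyson_le (fun u hu => hK u (hu.trans hs')) x₀ k)).trans ?_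
    gcongr
  refine hasDerivAt_tsum_of_isPreconnected
    (((Real.summable_pow_div_factorial (K * r)).mul_left ‖x₀‖).mul_left K) Metric.isOpen_ball
    (convex_ball (0 : ℝ) r).isPreconnected (fun k s _ => hasDerivAt_dyson_succ hF x₀ k s) hbound
    (Metric.mem_ball_self hr) ?_ (by simp [r])
  exact (summable_nat_add_iff 1).2 (summable_dyson hF x₀ 0)

theorem exists_hasDerivAt_eq_clm_apply [CompleteSpace E] (hF : Continuous F) (x₀ : E) :
    ∃ x : ℝ → E, x 0 = x₀ ∧ ∀ t, HasDerivAt x (F t (x t)) t := by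
  refine ⟨fun t => x₀ + ∑' k, dyson F x₀ (k + 1) t, by simp [dyson_succ_zero], fun t => ?_⟩
  have hsum := summable_dyson hF x₀ t
  have hval : F t (x₀ + ∑' k, dyson F x₀ (k + 1) t) = ∑' k, F t (dyson F x₀ k t) := by
    rw [← (F t).map_tsum hsum, hsum.tsum_eq_zero_add]
    rfl
  rw [hval]
  exact (hasDerivAt_tsum_dyson_succ hF x₀ t).const_add x₀

end LinearODE

section Propagator

variable {𝔸 : Type*} [NormedRing 𝔸] [NormedAlgebra ℝ 𝔸] {F Φ Ψ : ℝ → 𝔸} {t : ℝ}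

/-- `Φ` is the fundamental solution, on `[0, ∞)`, of the linear equation `x' = F x`, and `Ψ` is its
inverse. The functions are unconstrained at negative times. -/
structure IsPropagator (F Φ Ψ : ℝ → 𝔸) : Prop where
  zero : Φ 0 = 1
  hasDerivWithinAt : ∀ t, 0 ≤ t → HasDerivWithinAt Φ (F t * Φ t) (Set.Ici 0) t
  hasDerivWithinAt_inv : ∀ t, 0 ≤ t → HasDerivWithinAt Ψ (-(Ψ t * F t)) (Set.Ici 0) t
  inv_mul : ∀ t, 0 ≤ t → Ψ t * Φ t = 1

lemma eq_value_zero_of_hasDerivWithinAt_zero {E : Type*} [NormedAddCommGroup E] [NormedSpace ℝ E]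
    {f : ℝ → E} (hf : ∀ t, 0 ≤ t → HasDerivWithinAt f 0 (Set.Ici 0) t) (ht : 0 ≤ t) :
    f t = f 0 :=
  constant_of_has_deriv_right_zero
    (fun s hs => (hf s hs.1).continuousWithinAt.mono Set.Icc_subset_Ici_self)
    (fun s hs => (hf s hs.1).mono (Set.Ici_subset_Ici.2 hs.1)) t ⟨ht, le_rfl⟩

theorem exists_isPropagator [CompleteSpace 𝔸] (hF : ContinuousOn F (Set.Ici 0)) :
    ∃ Φ Ψ, IsPropagator F Φ Ψ := by
  set G : ℝ → 𝔸 := fun t => F (max t 0)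
  have hG : Continuous G := hF.comp_continuous (by fun_prop) fun t => le_max_right t 0
  have hGF : ∀ t, 0 ≤ t → G t = F t := fun t ht => congrArg F (max_eq_left ht)
  obtain ⟨Φ, hΦ0, hΦ⟩ := exists_hasDerivAt_eq_clm_apply
    ((ContinuousLinearMap.mul ℝ 𝔸).continuous.comp hG) 1
  obtain ⟨Ψ, hΨ0, hΨ⟩ := exists_hasDerivAt_eq_clm_apply
    ((ContinuousLinearMap.mul ℝ 𝔸).flip.continuous.comp hG).neg 1
  have hΦ' : ∀ t, 0 ≤ t → HasDerivWithinAt Φ (F t * Φ t) (Set.Ici 0) t := fun t ht => by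
    simpa [hGF t ht] using (hΦ t).hasDerivWithinAt
  have hΨ' : ∀ t, 0 ≤ t → HasDerivWithinAt Ψ (-(Ψ t * F t)) (Set.Ici 0) t := fun t ht => by
    simpa [hGF t ht] using (hΨ t).hasDerivWithinAt
  refine ⟨Φ, Ψ, hΦ0, hΦ', hΨ', fun t ht => ?_⟩
  have hconst : Ψ t * Φ t = Ψ 0 * Φ 0 :=
    eq_value_zero_of_hasDerivWithinAt_zero (f := fun t => Ψ t * Φ t) (fun s hs =>
      ((hΨ' s hs).mul (hΦ' s hs)).congr_deriv (by noncomm_ring)) ht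
  rw [hconst, hΦ0, hΨ0, one_mul]

namespace IsPropagator

lemma inv_zero (h : IsPropagator F Φ Ψ) : Ψ 0 = 1 := by
  simpa [h.zero] using h.inv_mul 0 le_rfl

lemma mul_inv [IsDedekindFiniteMonoid 𝔸] (h : IsPropagator F Φ Ψ) (ht : 0 ≤ t) : Φ t * Ψ t = 1 :=
  mul_eq_one_comm.1 (h.inv_mul t ht)

lemma continuousOn (h : IsPropagator F Φ Ψ) : ContinuousOn Φ (Set.Ici 0) :=
  fun t ht => (h.hasDerivWithinAt t ht).continuousWithinAt

lemma continuousOn_inv (h : IsPropagator F Φ Ψ) : ContinuousOn Ψ (Set.Ici 0) :=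
  fun t ht => (h.hasDerivWithinAt_inv t ht).continuousWithinAt

lemma contDiffOn (h : IsPropagator F Φ Ψ) (hF : ContinuousOn F (Set.Ici 0)) :
    ContDiffOn ℝ 1 Φ (Set.Ici 0) := by
  refine (contDiffOn_one_iff_derivWithin (uniqueDiffOn_Ici 0)).2
    ⟨fun t ht => (h.hasDerivWithinAt t ht).differentiableWithinAt, ?_⟩
  exact (hF.mul h.continuousOn).congr fun t ht =>
    (h.hasDerivWithinAt t ht).derivWithin (uniqueDiffOn_Ici 0 t ht)

lemma shift [IsDedekindFiniteMonoid 𝔸] (h : IsPropagator F Φ Ψ) {s : ℝ} (hs : 0 ≤ s) :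
    IsPropagator (fun t => F (s + t)) (fun t => Φ (s + t) * Ψ s) (fun t => Φ s * Ψ (s + t)) := by
  have hadd : ∀ t, HasDerivWithinAt (fun t => s + t) 1 (Set.Ici 0) t :=
    fun t => (hasDerivAt_id t).const_add s |>.hasDerivWithinAt
  have hmaps : Set.MapsTo (fun t => s + t) (Set.Ici 0) (Set.Ici 0) :=
    fun t ht => add_nonneg hs ht
  refine ⟨by rw [add_zero, h.mul_inv hs], fun t ht => ?_, fun t ht => ?_, fun t ht => ?_⟩
  · simpa [mul_assoc, Function.comp_def] using
      ((h.hasDerivWithinAt (s + t) (add_nonneg hs ht)).scomp t (hadd t) hmaps).mul_const (Ψ s)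
  · simpa [mul_assoc, Function.comp_def] using
      ((h.hasDerivWithinAt_inv (s + t) (add_nonneg hs ht)).scomp t (hadd t) hmaps).const_mul (Φ s)
  · rw [mul_assoc, ← mul_assoc (Ψ (s + t)), h.inv_mul _ (add_nonneg hs ht), one_mul, h.mul_inv hs]

theorem exists_tendsto_inv [CompleteSpace 𝔸] (h : IsPropagator F Φ Ψ) {C : ℝ}
    (hΨ : ∀ t, 0 ≤ t → ‖Ψ t‖ ≤ C) (hF : IntegrableOn F (Set.Ioi 0)) :
    ∃ T, Tendsto Ψ atTop (𝓝 T) := by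
  have hderiv : ∀ t ∈ Set.Ioi (0 : ℝ), HasDerivAt Ψ (-(Ψ t * F t)) t := fun t ht =>
    (h.hasDerivWithinAt_inv t ht.le).hasDerivAt (Ici_mem_nhds ht)
  have hint : IntegrableOn (fun t => -(Ψ t * F t)) (Set.Ioi 0) :=
    (hF.bdd_mul ((h.continuousOn_inv.mono Set.Ioi_subset_Ici_self).aestronglyMeasurable
      measurableSet_Ioi) ((ae_restrict_mem measurableSet_Ioi).mono fun t ht => hΨ t ht.le)).neg
  exact ⟨_, tendsto_limUnder_of_hasDerivAt_of_integrableOn_Ioi hderiv hint⟩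

lemma inv_mul_mul_star_inv [StarRing 𝔸] [NormedStarGroup 𝔸] [StarModule ℝ 𝔸]
    (h : IsPropagator F Φ Ψ) {V : ℝ → 𝔸}
    (hV : ∀ t, 0 ≤ t → HasDerivWithinAt V (F t * V t + V t * star (F t)) (Set.Ici 0) t)
    (ht : 0 ≤ t) : Ψ t * V t * star (Ψ t) = V 0 := by
  have hconst := eq_value_zero_of_hasDerivWithinAt_zero (f := fun t => Ψ t * V t * star (Ψ t))
    (fun s hs => by
      have hΨ := h.hasDerivWithinAt_inv s hs
      refine ((hΨ.mul (hV s hs)).mul hΨ.star).congr_deriv ?_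
      rw [star_neg, star_mul, Pi.mul_apply]
      noncomm_ring) ht
  simpa [h.inv_zero] using hconst

end IsPropagator

end Propagator

variable {n : ℕ} {A B M : Matrix (Fin n) (Fin n) ℝ}

section App

lemma app_mul (M N : Matrix (Fin n) (Fin n) ℝ) (x : Space n) :
    app (M * N) x = app M (app N x) := by
  simp [app]

@[simp] lemma app_one (x : Space n) : app 1 x = x := by simp [app]

lemma app_add (M N : Matrix (Fin n) (Fin n) ℝ) (x : Space n) :
    app (M + N) x = app M x + app N x := by simp [app]

lemma app_sub (M N : Matrix (Fin n) (Fin n) ℝ) (x : Space n) :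
    app (M - N) x = app M x - app N x := by simp [app]

lemma app_map_add (M : Matrix (Fin n) (Fin n) ℝ) (x y : Space n) :
    app M (x + y) = app M x + app M y := by simp [app]

lemma app_map_smul (M : Matrix (Fin n) (Fin n) ℝ) (c : ℝ) (x : Space n) :
    app M (c • x) = c • app M x := by simp [app]

/-- The identification of matrices with continuous linear maps, as a continuous linear map. -/
def appCLM : Matrix (Fin n) (Fin n) ℝ →L[ℝ] (Space n →L[ℝ] Space n) :=
  LinearMap.toContinuousLinearMap
    (Matrix.toEuclideanCLM (n := Fin n) (𝕜 := ℝ)).toAlgEquiv.toLinearMap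

lemma appCLM_apply (M : Matrix (Fin n) (Fin n) ℝ) (x : Space n) : appCLM M x = app M x := rfl

lemma appCLM_injective : Function.Injective (appCLM (n := n)) :=
  (Matrix.toEuclideanCLM (n := Fin n) (𝕜 := ℝ)).injective

lemma inner_app_left (M : Matrix (Fin n) (Fin n) ℝ) (x y : Space n) :
    inner ℝ (app M x) y = inner ℝ x (app Mᴴ y) := by
  rw [← Matrix.star_eq_conjTranspose, app, app, map_star, ContinuousLinearMap.star_eq_adjoint,
    ContinuousLinearMap.adjoint_inner_right]

lemma norm_app_le (M : Matrix (Fin n) (Fin n) ℝ) (x : Space n) : ‖app M x‖ ≤ ‖M‖ * ‖x‖ :=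
  (appCLM M).le_opNorm x

lemma norm_le_of_app (M : Matrix (Fin n) (Fin n) ℝ) {c : ℝ} (hc : 0 ≤ c)
    (h : ∀ x, ‖app M x‖ ≤ c * ‖x‖) : ‖M‖ ≤ c :=
  (appCLM M).opNorm_le_bound hc h

lemma lipschitzWith_app {c : NNReal} (h : ‖M‖ ≤ c) : LipschitzWith c (app M) :=
  (appCLM M).lipschitz.weaken h

lemma contDiff_app (M : Matrix (Fin n) (Fin n) ℝ) {k : WithTop ℕ∞} : ContDiff ℝ k (app M) :=
  (appCLM M).contDiff

lemma continuous_app (M : Matrix (Fin n) (Fin n) ℝ) : Continuous (app M) :=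
  (appCLM M).continuous

lemma tendstoUniformlyOn_app {ι : Type*} {l : Filter ι} {N : ι → Matrix (Fin n) (Fin n) ℝ}
    (h : Tendsto N l (𝓝 M)) {K : Set (Space n)} (hK : Bornology.IsBounded K) :
    TendstoUniformlyOn (fun i => app (N i)) (app M) l K := by
  obtain ⟨C, hC⟩ := hK.exists_norm_le
  have hlim : Tendsto (fun i => ‖M - N i‖ * C) l (𝓝 0) := by
    simpa using (h.const_sub M).norm.mul_const C
  rw [Metric.tendstoUniformlyOn_iff]
  intro ε hε
  filter_upwards [hlim.eventually_lt_const hε] with i hi x hx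
  calc dist (app M x) (app (N i) x) = ‖app (M - N i) x‖ := by rw [dist_eq_norm, app_sub]
    _ ≤ ‖M - N i‖ * ‖x‖ := norm_app_le _ x
    _ ≤ ‖M - N i‖ * C := by gcongr; exact hC x hx
    _ < ε := hi

lemma hasDerivWithinAt_app {X : ℝ → Matrix (Fin n) (Fin n) ℝ} {X' : Matrix (Fin n) (Fin n) ℝ}
    {s : Set ℝ} {t : ℝ} (h : HasDerivWithinAt X X' s t) (x : Space n) :
    HasDerivWithinAt (fun s => app (X s) x) (app X' x) s t :=
  (((ContinuousLinearMap.apply ℝ (Space n) x).comp appCLM).hasFDerivAt.comp_hasDerivWithinAt t h)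

end App

section Quad

variable {x : Space n}

lemma continuous_quad (M : Matrix (Fin n) (Fin n) ℝ) : Continuous (quad M) :=
  continuous_id.inner (continuous_app M)

@[simp] lemma quad_zero (M : Matrix (Fin n) (Fin n) ℝ) : quad M 0 = 0 := by simp [quad]

lemma quad_add (M N : Matrix (Fin n) (Fin n) ℝ) (x : Space n) :
    quad (M + N) x = quad M x + quad N x := by
  simp [quad, app_add, inner_add_right]

lemma quad_sub (M N : Matrix (Fin n) (Fin n) ℝ) (x : Space n) :
    quad (M - N) x = quad M x - quad N x := by
  simp [quad, app_sub, inner_sub_right]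

lemma quad_one (x : Space n) : quad 1 x = ‖x‖ ^ 2 := by simp [quad]

lemma quad_smul (M : Matrix (Fin n) (Fin n) ℝ) (c : ℝ) (x : Space n) :
    quad M (c • x) = c ^ 2 * quad M x := by
  rw [quad, app_map_smul, real_inner_smul_left, real_inner_smul_right, ← quad]
  ring

lemma quad_app (M L : Matrix (Fin n) (Fin n) ℝ) (x : Space n) :
    quad M (app L x) = quad (Lᴴ * M * L) x := by
  rw [quad, quad, inner_app_left, ← app_mul, ← app_mul, mul_assoc]

lemma quad_map_add (hM : M.IsHermitian) (x y : Space n) :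
    quad M (x + y) = quad M x + 2 * inner ℝ x (app M y) + quad M y := by
  have hxy : inner ℝ y (app M x) = inner ℝ x (app M y) := by
    rw [real_inner_comm, inner_app_left, hM.eq]
  simp only [quad, app_map_add, inner_add_left, inner_add_right, hxy]
  ring

lemma quad_nonneg (hM : M.PosSemidef) (x : Space n) : 0 ≤ quad M x := by
  rw [quad, app, Matrix.inner_toEuclideanCLM]
  simpa using hM.dotProduct_mulVec_nonneg x.ofLp

lemma quad_pos (hM : M.PosDef) (hx : x ≠ 0) : 0 < quad M x := by
  rw [quad, app, Matrix.inner_toEuclideanCLM]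
  simpa using hM.dotProduct_mulVec_pos (x := x.ofLp) (by simpa using hx)

lemma posSemidef_of_quad (hM : M.IsHermitian) (h : ∀ x, 0 ≤ quad M x) : M.PosSemidef := by
  refine Matrix.PosSemidef.of_dotProduct_mulVec_nonneg hM fun x => ?_
  have := h (WithLp.toLp 2 x)
  rw [quad, app, Matrix.inner_toEuclideanCLM] at this
  simpa using this

lemma exists_quad_lower_bound (hM : M.PosDef) : ∃ c > 0, ∀ x, c * ‖x‖ ^ 2 ≤ quad M x := by
  rcases subsingleton_or_nontrivial (Space n) with hs | hs
  · exact ⟨1, one_pos, fun x => by simp [Subsingleton.elim x 0]⟩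
  obtain ⟨z, hz, hmin⟩ := (isCompact_sphere (0 : Space n) 1).exists_isMinOn
    (NormedSpace.sphere_nonempty.2 zero_le_one) (continuous_quad M).continuousOn
  refine ⟨quad M z, quad_pos hM (ne_zero_of_mem_unit_sphere ⟨z, hz⟩), fun x => ?_⟩
  rcases eq_or_ne x 0 with rfl | hx
  · simp
  have hx' : 0 < ‖x‖ := norm_pos_iff.2 hx
  have hzx : quad M z ≤ quad M (‖x‖⁻¹ • x) := hmin (by simp [norm_smul, hx'.ne'])
  calc quad M z * ‖x‖ ^ 2 ≤ quad M (‖x‖⁻¹ • x) * ‖x‖ ^ 2 := by gcongr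
    _ = quad M x := by rw [quad_smul]; field_simp

lemma norm_inv_le_of_quad_lower_bound {c : ℝ} (hc : 0 < c) (hM : IsUnit M.det)
    (h : ∀ x, c * ‖x‖ ^ 2 ≤ quad M x) : ‖M⁻¹‖ ≤ c⁻¹ := by
  refine norm_le_of_app _ (inv_nonneg.2 hc.le) fun x => ?_
  set y := app M⁻¹ x
  have hy : app M y = x := by rw [← app_mul, Matrix.mul_nonsing_inv _ hM, app_one]
  have hxy : c * ‖y‖ ^ 2 ≤ ‖y‖ * ‖x‖ := by
    refine (h y).trans ?_
    rw [quad, hy]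
    exact real_inner_le_norm y x
  rcases (norm_nonneg y).eq_or_lt with h0 | h0
  · rw [← h0]; positivity
  · rw [inv_mul_eq_div, le_div_iff₀ hc]
    nlinarith

lemma hasGradientAt_half_quad (hM : M.IsHermitian) (x : Space n) :
    HasGradientAt (fun x => 1 / 2 * quad M x) (app M x) x := by
  have hquad := (((hasFDerivAt_id x).inner ℝ (appCLM M).hasFDerivAt).const_mul (1 / 2 : ℝ))
  rw [hasGradientAt_iff_hasFDerivAt]
  refine hquad.congr_fderiv ?_
  ext v
  have hxv : inner ℝ x (app M v) = inner ℝ (app M x) v := by rw [inner_app_left, hM.eq]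
  have hvx : inner ℝ v (app M x) = inner ℝ (app M x) v := real_inner_comm _ _
  change 1 / 2 * (inner ℝ x (app M v) + inner ℝ v (app M x)) = inner ℝ (app M x) v
  rw [hxv, hvx]
  ring

lemma convexOn_half_quad (hM : M.PosSemidef) :
    ConvexOn ℝ Set.univ fun x : Space n => 1 / 2 * quad M x := by
  refine ⟨convex_univ, fun x _ y _ a b ha hb hab => ?_⟩
  have hxy := quad_nonneg hM (x - y)
  rw [sub_eq_add_neg, ← neg_one_smul ℝ y, quad_map_add hM.isHermitian, quad_smul, app_map_smul,
    real_inner_smul_right] at hxy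
  simp only [quad_map_add hM.isHermitian, quad_smul, app_map_smul, real_inner_smul_left,
    real_inner_smul_right, smul_eq_mul]
  obtain rfl : b = 1 - a := by linarith
  nlinarith [mul_nonneg (mul_nonneg ha hb) hxy]

end Quad

section LinearFlow

variable {F Φ Ψ : ℝ → Matrix (Fin n) (Fin n) ℝ} {c t : ℝ}

lemma IsPropagator.exp_mul_norm_le_norm_app (h : IsPropagator F Φ Ψ)
    (hF : ∀ t, 0 ≤ t → ∀ x, c * ‖x‖ ^ 2 ≤ quad (F t) x) (ht : 0 ≤ t) (x : Space n) :
    Real.exp (c * t) * ‖x‖ ≤ ‖app (Φ t) x‖ := by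
  have hderiv : ∀ s, 0 ≤ s → HasDerivWithinAt
      (fun s => Real.exp (-(2 * c) * s) * ‖app (Φ s) x‖ ^ 2)
      (2 * Real.exp (-(2 * c) * s) * (quad (F s) (app (Φ s) x) - c * ‖app (Φ s) x‖ ^ 2))
      (Set.Ici 0) s := fun s hs => by
    have hnorm := (hasDerivWithinAt_app (h.hasDerivWithinAt s hs) x).norm_sq
    have hexp := ((hasDerivAt_id s).const_mul (-(2 * c))).exp.hasDerivWithinAt (s := Set.Ici 0)
    refine (hexp.mul hnorm).congr_deriv ?_
    rw [app_mul, ← quad]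
    simp only [id]
    ring
  have hmono : MonotoneOn (fun s => Real.exp (-(2 * c) * s) * ‖app (Φ s) x‖ ^ 2) (Set.Ici 0) := by
    refine monotoneOn_of_hasDerivWithinAt_nonneg (convex_Ici 0)
      (fun s hs => (hderiv s hs).continuousWithinAt)
      (fun s hs => (hderiv s (interior_subset hs)).mono interior_subset) fun s hs => ?_
    exact mul_nonneg (by positivity) (sub_nonneg.2 (hF s (interior_subset hs) _))
  have hle : ‖x‖ ^ 2 ≤ Real.exp (-(2 * c) * t) * ‖app (Φ t) x‖ ^ 2 := by
    simpa [h.zero] using hmono Set.self_mem_Ici (Set.mem_Ici.2 ht) ht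
  refine (pow_le_pow_iff_left₀ (by positivity) (norm_nonneg _) two_ne_zero).1 ?_
  calc (Real.exp (c * t) * ‖x‖) ^ 2 = Real.exp (2 * c * t) * ‖x‖ ^ 2 := by
        rw [mul_pow, ← Real.exp_nat_mul]
        push_cast
        ring_nf
    _ ≤ Real.exp (2 * c * t) * (Real.exp (-(2 * c) * t) * ‖app (Φ t) x‖ ^ 2) := by gcongr
    _ = ‖app (Φ t) x‖ ^ 2 := by
        rw [← mul_assoc, ← Real.exp_add]
        simp

lemma IsPropagator.norm_inv_le (h : IsPropagator F Φ Ψ)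
    (hF : ∀ t, 0 ≤ t → ∀ x, c * ‖x‖ ^ 2 ≤ quad (F t) x) (ht : 0 ≤ t) :
    ‖Ψ t‖ ≤ Real.exp (-c * t) := by
  refine norm_le_of_app _ (Real.exp_pos _).le fun x => ?_
  have hle := h.exp_mul_norm_le_norm_app hF ht (app (Ψ t) x)
  rw [← app_mul, h.mul_inv ht, app_one] at hle
  calc ‖app (Ψ t) x‖ = Real.exp (-c * t) * (Real.exp (c * t) * ‖app (Ψ t) x‖) := by
        rw [← mul_assoc, ← Real.exp_add]
        simp
    _ ≤ Real.exp (-c * t) * ‖x‖ := by gcongr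

lemma IsPropagator.locallyLipschitzOn (h : IsPropagator F Φ Ψ)
    (hF : ContinuousOn F (Set.Ici 0)) :
    LocallyLipschitzOn (Set.Ici (0 : ℝ) ×ˢ Set.univ)
      fun p : ℝ × Space n => app (Φ p.1) p.2 := by
  have hΦ : ContDiffOn ℝ 1 (fun p : ℝ × Space n => appCLM (Φ p.1))
      (Set.Ici (0 : ℝ) ×ˢ Set.univ) :=
    appCLM.contDiff.comp_contDiffOn
      ((h.contDiffOn hF).comp contDiff_fst.contDiffOn fun p hp => hp.1)
  exact (hΦ.clm_apply contDiff_snd.contDiffOn).locallyLipschitzOn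
    ((convex_Ici 0).prod convex_univ)

variable {w : ℝ → Space n → Space n}

lemma IsPropagator.isFlow (h : IsPropagator F Φ Ψ) (hF : ContinuousOn F (Set.Ici 0))
    (hw : ∀ t, 0 ≤ t → w t = app (F t)) :
    IsFlow w (fun t => app (Φ t)) (fun t => app (Ψ t)) where
  init x := by simp [h.zero]
  ode x t ht := by
    rw [hw t ht, ← app_mul]
    exact hasDerivWithinAt_app (h.hasDerivWithinAt t ht) x
  left_inv t ht x := by rw [← app_mul, h.inv_mul t ht, app_one]
  right_inv t ht x := by rw [← app_mul, h.mul_inv ht, app_one]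
  smooth t _ := contDiff_app _
  smooth_inv t _ := contDiff_app _
  locallyLipschitz := h.locallyLipschitzOn hF

lemma IsPropagator.inverse_flow_eq (h : IsPropagator F Φ Ψ)
    (hw : ∀ t, 0 ≤ t → w t = app (F t)) {S R : ℝ → Space n → Space n} (hS : IsFlow w S R)
    (ht : 0 ≤ t) : R t = app (Ψ t) := by
  ext1 y
  have hderiv : ∀ s, 0 ≤ s →
      HasDerivWithinAt (fun s => app (Ψ s) (S s (R t y))) 0 (Set.Ici 0) s := fun s hs => by
    have hΨ := (appCLM (n := n)).hasFDerivAt.comp_hasDerivWithinAt s (h.hasDerivWithinAt_inv s hs)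
    have hode := hS.ode (R t y) s hs
    rw [hw s hs] at hode
    refine (hΨ.clm_apply hode).congr_deriv ?_
    rw [map_neg, neg_apply, appCLM_apply, app_mul]
    exact neg_add_cancel _
  have hconst := eq_value_zero_of_hasDerivWithinAt_zero hderiv ht
  rw [hS.right_inv t ht y, h.inv_zero, app_one, hS.init] at hconst
  exact hconst.symm

theorem IsPropagator.isKimMilmanMap_iff (h : IsPropagator F Φ Ψ)
    (hF : ContinuousOn F (Set.Ici 0)) {f : Space n → ℝ}
    (hf : ∀ t, 0 ≤ t → velocity A f t = app (F t)) (hΨ : Tendsto Ψ atTop (𝓝 M))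
    (U : Space n → Space n) : IsKimMilmanMap A f U ↔ U = app M := by
  constructor
  · rintro ⟨S, R, hS, τ, hτ, hlim⟩
    ext1 y
    have hRU : Tendsto (fun k => R (τ k) y) atTop (𝓝 (U y)) :=
      (hlim {y} isCompact_singleton).tendsto_at rfl
    have hΨM : Tendsto (fun k => app (Ψ (τ k)) y) atTop (𝓝 (app M y)) :=
      (tendstoUniformlyOn_app (hΨ.comp hτ) (Bornology.isBounded_singleton (x := y))).tendsto_at rfl
    refine tendsto_nhds_unique hRU (hΨM.congr' ?_)
    filter_upwards [hτ.eventually_ge_atTop 0] with k hk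
    rw [h.inverse_flow_eq hf hS hk]
  · rintro rfl
    exact ⟨_, _, h.isFlow hF hf, fun k => k, tendsto_natCast_atTop_atTop, fun K hK =>
      tendstoUniformlyOn_app (hΨ.comp tendsto_natCast_atTop_atTop) hK.isBounded⟩

end LinearFlow

section GaussianIntegrals

lemma map_app_volume {L : Matrix (Fin n) (Fin n) ℝ} (hL : IsUnit L.det) :
    (volume : Measure (Space n)).map (app L) = ENNReal.ofReal |L.det⁻¹| • volume := by
  have hdet : LinearMap.det (Matrix.toEuclideanLin L) = L.det := by
    rw [Matrix.toEuclideanLin_eq_toLin_orthonormal, LinearMap.det_toLin]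
  rw [← hdet] at hL ⊢
  exact Measure.map_linearMap_addHaar_eq_smul_addHaar _ hL.ne_zero

lemma integral_comp_app {L : Matrix (Fin n) (Fin n) ℝ} (hL : IsUnit L.det) {g : Space n → ℝ}
    (hg : Continuous g) : ∫ x, g (app L x) = |L.det|⁻¹ * ∫ x, g x := by
  rw [← integral_map (μ := (volume : Measure (Space n))) (f := g)
    (continuous_app L).measurable.aemeasurable hg.aestronglyMeasurable, map_app_volume hL,
    integral_smul_measure, ENNReal.toReal_ofReal (abs_nonneg _), abs_inv, smul_eq_mul]

lemma abs_det_sqrt (hM : M.PosSemidef) : |(CFC.sqrt M).det| = √M.det := by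
  rw [← Real.sqrt_mul_self_eq_abs, ← Matrix.det_mul, CFC.sqrt_mul_sqrt_self M hM.nonneg]

lemma quad_eq_norm_sq_app_sqrt (hM : M.PosSemidef) (x : Space n) :
    quad M x = ‖app (CFC.sqrt M) x‖ ^ 2 := by
  rw [← quad_one, quad_app, mul_one, ← Matrix.star_eq_conjTranspose,
    (IsSelfAdjoint.of_nonneg (CFC.sqrt_nonneg M)).star_eq,
    CFC.sqrt_mul_sqrt_self M hM.nonneg]

lemma integral_exp_neg_quad (hM : M.PosDef) :
    ∫ x : Space n, Real.exp (-(1 / 2) * quad M x)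
      = (2 * Real.pi) ^ ((n : ℝ) / 2) / √M.det := by
  have hdet := abs_det_sqrt hM.posSemidef
  have hL : IsUnit (CFC.sqrt M).det := by
    rw [isUnit_iff_ne_zero, ← abs_pos, hdet]
    exact Real.sqrt_pos.2 hM.det_pos
  simp_rw [quad_eq_norm_sq_app_sqrt hM.posSemidef]
  rw [integral_comp_app hL (g := fun x => Real.exp (-(1 / 2) * ‖x‖ ^ 2)) (by fun_prop),
    GaussianFourier.integral_rexp_neg_mul_sq_norm (by norm_num), hdet, finrank_euclideanSpace_fin,
    inv_mul_eq_div]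
  congr 2
  ring

lemma quad_add_app_inv (hM : M.PosDef) (y b : Space n) :
    quad M (y + app M⁻¹ b) = quad M y + 2 * inner ℝ y b + quad M⁻¹ b := by
  have hMM : M * M⁻¹ = 1 := Matrix.mul_nonsing_inv _ (isUnit_det_of_posDef hM)
  rw [quad_map_add hM.isHermitian, ← app_mul, hMM, app_one, quad_app, mul_assoc, hMM, mul_one,
    hM.inv.isHermitian.eq]

lemma integral_exp_neg_quad_sub_inner (hM : M.PosDef) (b : Space n) :
    ∫ x : Space n, Real.exp (-(1 / 2) * quad M x - inner ℝ x b)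
      = (2 * Real.pi) ^ ((n : ℝ) / 2) / √M.det * Real.exp (1 / 2 * quad M⁻¹ b) := by
  rw [← integral_exp_neg_quad hM, ← integral_mul_const,
    ← integral_add_right_eq_self
      (fun x => Real.exp (-(1 / 2) * quad M x) * Real.exp (1 / 2 * quad M⁻¹ b)) (app M⁻¹ b)]
  congr 1 with x
  rw [← Real.exp_add, quad_add_app_inv hM]
  congr 1
  ring

lemma measurable_ofReal_mul_exp_neg_quad (A : Matrix (Fin n) (Fin n) ℝ) (c : ℝ) :
    Measurable fun x : Space n => ENNReal.ofReal (c * Real.exp (-(1 / 2) * quad A x)) :=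
  (continuous_const.mul (Real.continuous_exp.comp
    (continuous_const.mul (continuous_quad A)))).measurable.ennreal_ofReal

lemma integral_gaussian (A : Matrix (Fin n) (Fin n) ℝ) (g : Space n → ℝ) :
    ∫ y, g y ∂(gaussian A) = √A.det / (2 * Real.pi) ^ ((n : ℝ) / 2) *
      ∫ y, Real.exp (-(1 / 2) * quad A y) * g y := by
  rw [gaussian, integral_withDensity_eq_integral_toReal_smul
    (measurable_ofReal_mul_exp_neg_quad A _) (by simp), ← integral_const_mul]
  congr 1 with y
  rw [ENNReal.toReal_ofReal (by positivity), smul_eq_mul, mul_assoc]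

lemma integral_exp_neg_quad_sub_inner_gaussian (hA : A.PosDef) (hM : M.PosSemidef) (b : Space n) :
    ∫ y, Real.exp (-(1 / 2) * quad M y - inner ℝ y b) ∂(gaussian A)
      = √A.det / √(A + M).det * Real.exp (1 / 2 * quad (A + M)⁻¹ b) := by
  have hexp : ∀ y, Real.exp (-(1 / 2) * quad A y) * Real.exp (-(1 / 2) * quad M y - inner ℝ y b)
      = Real.exp (-(1 / 2) * quad (A + M) y - inner ℝ y b) := fun y => by
    rw [← Real.exp_add, quad_add]
    ring_nf
  have hpi : (2 * Real.pi) ^ ((n : ℝ) / 2) ≠ 0 := by positivity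
  simp_rw [integral_gaussian, hexp, integral_exp_neg_quad_sub_inner (hA.add_posSemidef hM)]
  field_simp

lemma tiltDensity_eq (hA : A.PosDef) (hB : B.PosSemidef) (x : Space n) :
    tiltDensity A B x = √(A + B).det / √A.det * Real.exp (-(1 / 2) * quad B x) := by
  have hmass := integral_exp_neg_quad_sub_inner_gaussian hA hB 0
  simp only [inner_zero_right, sub_zero, quad_zero, mul_zero, Real.exp_zero, mul_one] at hmass
  rw [tiltDensity, hmass, inv_div]

lemma target_tiltDensity (hA : A.PosDef) (hB : B.PosSemidef) :
    target A (tiltDensity A B) = gaussian (A + B) := by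
  have hm : Measurable fun x : Space n => ENNReal.ofReal (tiltDensity A B x) :=
    measurable_ofReal_mul_exp_neg_quad B _
  rw [target, gaussian, gaussian,
    ← withDensity_mul _ (measurable_ofReal_mul_exp_neg_quad A _) hm]
  congr 1 with x
  have := hA.det_pos
  rw [Pi.mul_apply, ← ENNReal.ofReal_mul (by positivity), tiltDensity_eq hA hB,
    quad_add, mul_add, Real.exp_add]
  congr 1
  field_simp

lemma volume_absolutelyContinuous_gaussian (hA : A.PosDef) : volume ≪ gaussian A := by
  have := hA.det_pos
  refine withDensity_absolutelyContinuous' (measurable_ofReal_mul_exp_neg_quad A _).aemeasurable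
    (Eventually.of_forall fun x => ?_)
  exact (ENNReal.ofReal_pos.2 (by positivity)).ne'

lemma map_withDensity_comp {α β : Type*} [MeasurableSpace α] [MeasurableSpace β] (μ : Measure α)
    {f : α → β} {g : β → ENNReal} (hf : Measurable f) (hg : Measurable g) :
    (μ.withDensity fun x => g (f x)).map f = (μ.map f).withDensity g := by
  ext s hs
  rw [Measure.map_apply hf hs, withDensity_apply _ hs, withDensity_apply _ (hf hs),
    setLIntegral_map hs hg hf]

theorem measurePreserving_app_gaussian {L : Matrix (Fin n) (Fin n) ℝ} (hA : A.PosDef)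
    (hB : B.PosDef) (hL : L * A⁻¹ * Lᴴ = B⁻¹) :
    MeasurePreserving (app L) (gaussian A) (gaussian B) := by
  have hconj : Lᴴ * B * L = A :=
    mul_mul_eq_of_mul_inv_mul_eq_inv (isUnit_det_of_posDef hA) (isUnit_det_of_posDef hB) hL
  have hdet : L.det ^ 2 * B.det = A.det := by
    rw [← hconj, Matrix.det_mul, Matrix.det_mul, Matrix.det_conjTranspose, star_trivial]
    ring
  have hL0 : L.det ≠ 0 := fun h => hA.det_pos.ne' (by rw [← hdet, h]; ring)
  have hm := measurable_ofReal_mul_exp_neg_quad B (√B.det / (2 * Real.pi) ^ ((n : ℝ) / 2))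
  have hgaussian : gaussian A = ENNReal.ofReal |L.det| • volume.withDensity fun x =>
      ENNReal.ofReal
        (√B.det / (2 * Real.pi) ^ ((n : ℝ) / 2) * Real.exp (-(1 / 2) * quad B (app L x))) := by
    have hmL : Measurable fun x => ENNReal.ofReal (√B.det / (2 * Real.pi) ^ ((n : ℝ) / 2) *
        Real.exp (-(1 / 2) * quad B (app L x))) := hm.comp (continuous_app L).measurable
    rw [gaussian, ← withDensity_smul _ hmL]
    congr 1 with x
    rw [Pi.smul_apply, smul_eq_mul, ← ENNReal.ofReal_mul (abs_nonneg _), quad_app, hconj, ← hdet,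
      Real.sqrt_mul (sq_nonneg _), Real.sqrt_sq_eq_abs]
    congr 1
    ring
  refine ⟨(continuous_app L).measurable, ?_⟩
  rw [hgaussian, Measure.map_smul, map_withDensity_comp _ (continuous_app L).measurable hm,
    map_app_volume hL0.isUnit, withDensity_smul_measure, smul_smul,
    ← ENNReal.ofReal_mul (abs_nonneg _), ← abs_mul, mul_inv_cancel₀ hL0]
  simp [gaussian]

end GaussianIntegrals

section Decay

variable {t : ℝ}

/-- The matrix `e^{-tA}` of the Mehler formula. -/
def decay (A : Matrix (Fin n) (Fin n) ℝ) (t : ℝ) : Matrix (Fin n) (Fin n) ℝ :=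
  NormedSpace.exp (-t • A)

@[simp] lemma decay_zero (A : Matrix (Fin n) (Fin n) ℝ) : decay A 0 = 1 := by simp [decay]

lemma decay_add (A : Matrix (Fin n) (Fin n) ℝ) (s t : ℝ) :
    decay A (s + t) = decay A s * decay A t := by
  rw [decay, decay, decay, ← Matrix.exp_add_of_commute, neg_add, add_smul]
  exact ((Commute.refl A).smul_left _).smul_right _

lemma decay_mul_decay_neg (A : Matrix (Fin n) (Fin n) ℝ) (t : ℝ) :
    decay A t * decay A (-t) = 1 := by
  rw [← decay_add, add_neg_cancel, decay_zero]

lemma decay_neg_mul_decay (A : Matrix (Fin n) (Fin n) ℝ) (t : ℝ) :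
    decay A (-t) * decay A t = 1 := by
  rw [← decay_add, neg_add_cancel, decay_zero]

lemma isUnit_decay (A : Matrix (Fin n) (Fin n) ℝ) (t : ℝ) : IsUnit (decay A t) :=
  .of_mul_eq_one _ (decay_mul_decay_neg A t)

lemma inv_decay (A : Matrix (Fin n) (Fin n) ℝ) (t : ℝ) : (decay A t)⁻¹ = decay A (-t) :=
  Matrix.inv_eq_right_inv (decay_mul_decay_neg A t)

lemma isHermitian_decay (hA : A.IsHermitian) (t : ℝ) : (decay A t).IsHermitian :=
  Matrix.IsHermitian.exp (hA.smul (.all _))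

lemma commute_decay (A : Matrix (Fin n) (Fin n) ℝ) (t : ℝ) : Commute A (decay A t) :=
  ((Commute.refl A).smul_right _).exp_right

lemma hasDerivAt_decay (A : Matrix (Fin n) (Fin n) ℝ) (t : ℝ) :
    HasDerivAt (decay A) (-(decay A t * A)) t := by
  have hexp := (hasDerivAt_exp_smul_const (𝕂 := ℝ) A (-t)).scomp t (hasDerivAt_neg t)
  exact hexp.congr_deriv (by rw [neg_one_smul, decay])

lemma continuous_decay (A : Matrix (Fin n) (Fin n) ℝ) : Continuous (decay A) :=
  continuous_iff_continuousAt.2 fun t => (hasDerivAt_decay A t).continuousAt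

lemma isPropagator_decay (A : Matrix (Fin n) (Fin n) ℝ) :
    IsPropagator (fun _ => A) (fun t => decay A (-t)) (decay A) where
  zero := by simp
  hasDerivWithinAt t _ :=
    (((hasDerivAt_decay A (-t)).scomp t (hasDerivAt_neg t)).congr_deriv (by
      rw [neg_one_smul, neg_neg, (commute_decay A (-t)).eq])).hasDerivWithinAt
  hasDerivWithinAt_inv t _ := (hasDerivAt_decay A t).hasDerivWithinAt
  inv_mul t _ := decay_mul_decay_neg A t

lemma norm_decay_le {c : ℝ} (hc : ∀ x, c * ‖x‖ ^ 2 ≤ quad A x) (ht : 0 ≤ t) :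
    ‖decay A t‖ ≤ Real.exp (-c * t) :=
  (isPropagator_decay A).norm_inv_le (fun _ _ => hc) ht

lemma tendsto_decay_atTop (hA : A.PosDef) : Tendsto (decay A) atTop (𝓝 0) := by
  obtain ⟨a, ha, haq⟩ := exists_quad_lower_bound hA
  refine squeeze_zero_norm' ((eventually_ge_atTop 0).mono fun t ht => norm_decay_le haq ht) ?_
  simpa [Function.comp_def] using
    Real.tendsto_exp_neg_atTop_nhds_zero.comp (tendsto_id.const_mul_atTop ha)

/-- The matrix `√(Id - e^{-2tA})` of the Mehler formula. -/
def spread (A : Matrix (Fin n) (Fin n) ℝ) (t : ℝ) : Matrix (Fin n) (Fin n) ℝ :=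
  CFC.sqrt (1 - NormedSpace.exp (-(2 * t) • A))

lemma spread_eq (A : Matrix (Fin n) (Fin n) ℝ) (t : ℝ) :
    spread A t = CFC.sqrt (1 - decay A t * decay A t) := by
  rw [← decay_add, ← two_mul]
  rfl

lemma isHermitian_spread (A : Matrix (Fin n) (Fin n) ℝ) (t : ℝ) : (spread A t).IsHermitian :=
  IsSelfAdjoint.of_nonneg (CFC.sqrt_nonneg _)

lemma posSemidef_one_sub_decay_mul_decay (hA : A.PosSemidef) (ht : 0 ≤ t) :
    (1 - decay A t * decay A t).PosSemidef := by
  have hE := isHermitian_decay hA.isHermitian t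
  refine posSemidef_of_quad ?_ fun x => ?_
  · simpa only [hE.eq] using
      Matrix.isHermitian_one.sub (Matrix.isHermitian_conjTranspose_mul_self (decay A t))
  have hnorm : ‖decay A t‖ ≤ 1 := by
    simpa using norm_decay_le (c := 0) (by simpa using quad_nonneg hA) ht
  have hx : ‖app (decay A t) x‖ ≤ ‖x‖ :=
    (norm_app_le _ x).trans (mul_le_of_le_one_left (norm_nonneg x) hnorm)
  have hquad : quad (decay A t * decay A t) x = ‖app (decay A t) x‖ ^ 2 := by
    rw [← quad_one, quad_app, mul_one, hE.eq]
  rw [quad_sub, quad_one, hquad, sub_nonneg]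
  gcongr

lemma spread_mul_spread (hA : A.PosSemidef) (ht : 0 ≤ t) :
    spread A t * spread A t = 1 - decay A t * decay A t := by
  rw [spread_eq]
  exact CFC.sqrt_mul_sqrt_self _ (posSemidef_one_sub_decay_mul_decay hA ht).nonneg

lemma commute_spread (A : Matrix (Fin n) (Fin n) ℝ) (t : ℝ) : Commute (spread A t) A := by
  rw [spread_eq, CFC.sqrt]
  have hE := (commute_decay A t).symm
  exact ((Commute.one_left A).sub_left (hE.mul_left hE)).cfcₙ_nnreal _

lemma spread_mul_inv_mul_spread (hA : A.PosSemidef) (ht : 0 ≤ t) :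
    spread A t * A⁻¹ * spread A t = A⁻¹ - decay A t * A⁻¹ * decay A t := by
  rw [(commute_inv_right (commute_spread A t)).eq,
    (commute_inv_right (commute_decay A t).symm).eq, mul_assoc, mul_assoc,
    spread_mul_spread hA ht, mul_sub, mul_one]

end Decay

section EvolvedTilt

variable {s t : ℝ}

/-- The matrix `B_t` with `P_t^A f_{A,B} = f_{A,B_t}`. It solves the Riccati equation
`B_t' = -(A B_t + B_t A + 2 B_t²)`, which is linear in `B_t⁻¹`:
`A⁻¹ + B_t⁻¹ = e^{tA} (A⁻¹ + B⁻¹) e^{tA}`. -/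
def evolvedTilt (A B : Matrix (Fin n) (Fin n) ℝ) (t : ℝ) : Matrix (Fin n) (Fin n) ℝ :=
  (decay A (-t) * (A⁻¹ + B⁻¹) * decay A (-t) - A⁻¹)⁻¹

lemma evolvedTilt_zero (hB : IsUnit B.det) : evolvedTilt A B 0 = B := by
  rw [evolvedTilt, neg_zero, decay_zero, one_mul, mul_one, add_sub_cancel_left,
    Matrix.nonsing_inv_nonsing_inv _ hB]

lemma evolvedTilt_eq (hA : A.PosSemidef) (ht : 0 ≤ t) :
    evolvedTilt A B t
      = decay A t * (B⁻¹ + spread A t * A⁻¹ * spread A t)⁻¹ * decay A t := by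
  have hconj : decay A (-t) * (decay A t * A⁻¹ * decay A t) * decay A (-t) = A⁻¹ := by
    rw [← mul_assoc, ← mul_assoc, decay_neg_mul_decay, one_mul, mul_assoc, decay_mul_decay_neg,
      mul_one]
  have hinv : decay A (-t) * (A⁻¹ + B⁻¹) * decay A (-t) - A⁻¹
      = decay A (-t) * (B⁻¹ + spread A t * A⁻¹ * spread A t) * decay A (-t) := by
    rw [spread_mul_inv_mul_spread hA ht]
    simp only [mul_add, add_mul, mul_sub, sub_mul, hconj]
    abel
  rw [evolvedTilt, hinv, Matrix.mul_inv_rev, Matrix.mul_inv_rev, inv_decay, neg_neg, ← mul_assoc]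

lemma posSemidef_spread_mul_inv_mul_spread (hA : A.PosSemidef) (t : ℝ) :
    (spread A t * A⁻¹ * spread A t).PosSemidef := by
  simpa only [(isHermitian_spread A t).eq] using
    hA.inv.mul_mul_conjTranspose_same (spread A t)

lemma posDef_evolvedTilt (hA : A.PosSemidef) (hB : B.PosDef) (ht : 0 ≤ t) :
    (evolvedTilt A B t).PosDef := by
  rw [evolvedTilt_eq hA ht]
  simpa only [(isHermitian_decay hA.isHermitian t).eq] using posDef_mul_mul_conjTranspose
    (hB.inv.add_posSemidef (posSemidef_spread_mul_inv_mul_spread hA t)).inv (isUnit_decay A t)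

lemma isUnit_det_inv_evolvedTilt (hA : A.PosSemidef) (hB : B.PosDef) (ht : 0 ≤ t) :
    IsUnit (decay A (-t) * (A⁻¹ + B⁻¹) * decay A (-t) - A⁻¹).det :=
  Matrix.isUnit_nonsing_inv_det_iff.1 (isUnit_det_of_posDef (posDef_evolvedTilt hA hB ht))

lemma inv_evolvedTilt (hA : A.PosSemidef) (hB : B.PosDef) (ht : 0 ≤ t) :
    (evolvedTilt A B t)⁻¹ = decay A (-t) * (A⁻¹ + B⁻¹) * decay A (-t) - A⁻¹ :=
  Matrix.nonsing_inv_nonsing_inv _ (isUnit_det_inv_evolvedTilt hA hB ht)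

lemma evolvedTilt_evolvedTilt (hA : A.PosSemidef) (hB : B.PosDef) (hs : 0 ≤ s) (t : ℝ) :
    evolvedTilt A (evolvedTilt A B s) t = evolvedTilt A B (s + t) := by
  have hts : decay A (-(s + t)) = decay A (-t) * decay A (-s) := by
    rw [← decay_add, neg_add_rev]
  have hst : decay A (-(s + t)) = decay A (-s) * decay A (-t) := by
    rw [← decay_add, neg_add]
  rw [evolvedTilt, inv_evolvedTilt hA hB hs, add_sub_cancel, evolvedTilt]
  nth_rewrite 1 [hts]
  rw [hst]
  simp only [mul_assoc]

lemma commute_of_commute_evolvedTilt (hA : A.PosSemidef) (hB : B.PosDef) (ht : 0 ≤ t)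
    (h : Commute A (evolvedTilt A B t)) : Commute A B := by
  have hAA : Commute A A⁻¹ := commute_inv_right (Commute.refl A)
  have hconj : Commute A (decay A (-t) * (A⁻¹ + B⁻¹) * decay A (-t)) := by
    simpa only [inv_evolvedTilt hA hB ht, sub_add_cancel] using
      (commute_inv_right h).add_right hAA
  have hsum : decay A t * (decay A (-t) * (A⁻¹ + B⁻¹) * decay A (-t)) * decay A t
      = A⁻¹ + B⁻¹ := by
    rw [← mul_assoc, ← mul_assoc, decay_mul_decay_neg, one_mul, mul_assoc, decay_neg_mul_decay,
      mul_one]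
  have hB' : Commute A B⁻¹ := by
    simpa only [hsum, add_sub_cancel_left] using
      (((commute_decay A t).mul_right hconj).mul_right (commute_decay A t)).sub_right hAA
  simpa only [Matrix.nonsing_inv_nonsing_inv _ (isUnit_det_of_posDef hB)] using
    commute_inv_right hB'

lemma norm_evolvedTilt_le {a b : ℝ} (hA : A.PosSemidef) (hB : B.PosDef)
    (ha : ∀ x, a * ‖x‖ ^ 2 ≤ quad A x) (hb : 0 < b) (hbB : ∀ x, b * ‖x‖ ^ 2 ≤ quad B⁻¹ x)
    (ht : 0 ≤ t) : ‖evolvedTilt A B t‖ ≤ b⁻¹ * Real.exp (-(2 * a) * t) := by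
  have hσ := posSemidef_spread_mul_inv_mul_spread hA t
  have hG : ‖(B⁻¹ + spread A t * A⁻¹ * spread A t)⁻¹‖ ≤ b⁻¹ := by
    refine norm_inv_le_of_quad_lower_bound hb
      (isUnit_det_of_posDef (hB.inv.add_posSemidef hσ)) fun x => ?_
    rw [quad_add]
    linarith [hbB x, quad_nonneg hσ x]
  have hE := norm_decay_le ha ht
  rw [evolvedTilt_eq hA ht]
  calc _ ≤ ‖decay A t‖ * ‖(B⁻¹ + spread A t * A⁻¹ * spread A t)⁻¹‖ * ‖decay A t‖ :=
        (norm_mul_le _ _).trans (by gcongr; exact norm_mul_le _ _)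
    _ ≤ Real.exp (-a * t) * b⁻¹ * Real.exp (-a * t) := by gcongr
    _ = b⁻¹ * Real.exp (-(2 * a) * t) := by
        rw [mul_right_comm, ← Real.exp_add, mul_comm]
        congr 2
        ring

lemma continuousOn_evolvedTilt (hA : A.PosSemidef) (hB : B.PosDef) :
    ContinuousOn (evolvedTilt A B) (Set.Ici 0) := by
  intro t ht
  have hE := continuous_decay A
  have hinv : ContinuousAt (fun t => decay A (-t) * (A⁻¹ + B⁻¹) * decay A (-t) - A⁻¹) t := by
    fun_prop
  obtain ⟨u, hu⟩ := (Matrix.isUnit_iff_isUnit_det _).2 (isUnit_det_inv_evolvedTilt hA hB ht)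
  have hring := NormedRing.inverse_continuousAt u
  rw [hu] at hring
  refine (hring.comp_of_eq hinv rfl).continuousWithinAt.congr (fun s _ => ?_) ?_ <;>
    exact Matrix.nonsing_inv_eq_ringInverse _

lemma integrableOn_evolvedTilt (hA : A.PosDef) (hB : B.PosDef) :
    IntegrableOn (evolvedTilt A B) (Set.Ioi 0) := by
  obtain ⟨b, hb, hbB⟩ := exists_quad_lower_bound hB.inv
  obtain ⟨a, ha, haA⟩ := exists_quad_lower_bound hA
  have hexp : IntegrableOn (fun t => b⁻¹ * Real.exp (-(2 * a) * t)) (Set.Ioi 0) :=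
    (integrableOn_exp_mul_Ioi (by linarith) 0).const_mul _
  refine Integrable.mono' hexp (((continuousOn_evolvedTilt hA.posSemidef hB).mono
    Set.Ioi_subset_Ici_self).aestronglyMeasurable measurableSet_Ioi) ?_
  exact (ae_restrict_mem measurableSet_Ioi).mono fun t ht =>
    norm_evolvedTilt_le hA.posSemidef hB haA hb hbB (le_of_lt ht)

lemma inv_add_evolvedTilt (hA : A.PosDef) (hB : B.PosDef) (ht : 0 ≤ t) :
    (A + evolvedTilt A B t)⁻¹
      = A⁻¹ - A⁻¹ * decay A t * (A⁻¹ + B⁻¹)⁻¹ * decay A t * A⁻¹ := by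
  set G := B⁻¹ + spread A t * A⁻¹ * spread A t with hG
  have hGpos : G.PosDef :=
    hB.inv.add_posSemidef (posSemidef_spread_mul_inv_mul_spread hA.posSemidef t)
  have hsum : G⁻¹⁻¹ + decay A t * A⁻¹ * decay A t = A⁻¹ + B⁻¹ := by
    rw [Matrix.nonsing_inv_nonsing_inv _ (isUnit_det_of_posDef hGpos), hG,
      spread_mul_inv_mul_spread hA.posSemidef ht]
    abel
  rw [evolvedTilt_eq hA.posSemidef ht, ← hG, Matrix.add_mul_mul_inv_eq_sub _ _ _ _ hA.isUnit
    hGpos.inv.isUnit (by rw [hsum]; exact (hA.inv.add hB.inv).isUnit), hsum]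

lemma hasDerivWithinAt_inv_add_evolvedTilt (hA : A.PosDef) (hB : B.PosDef) (ht : 0 ≤ t) :
    HasDerivWithinAt (fun t => (A + evolvedTilt A B t)⁻¹)
      (evolvedTilt A B t * (A + evolvedTilt A B t)⁻¹
        + (A + evolvedTilt A B t)⁻¹ * star (evolvedTilt A B t)) (Set.Ici 0) t := by
  have hAu := isUnit_det_of_posDef hA
  have hpos := posDef_evolvedTilt hA.posSemidef hB ht
  have hsum := isUnit_det_of_posDef (hA.add hpos)
  have hleft : evolvedTilt A B t * (A + evolvedTilt A B t)⁻¹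
      = 1 - A * (A + evolvedTilt A B t)⁻¹ := by
    rw [eq_sub_iff_add_eq', ← add_mul, Matrix.mul_nonsing_inv _ hsum]
  have hright : (A + evolvedTilt A B t)⁻¹ * star (evolvedTilt A B t)
      = 1 - (A + evolvedTilt A B t)⁻¹ * A := by
    rw [Matrix.star_eq_conjTranspose, hpos.isHermitian.eq, eq_sub_iff_add_eq', ← mul_add,
      Matrix.nonsing_inv_mul _ hsum]
  have hE := hasDerivAt_decay A t
  have hE' : HasDerivAt (decay A) (-(A * decay A t)) t := by rwa [(commute_decay A t).eq]
  have hderiv :=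
    ((((hE'.const_mul A⁻¹).mul_const (A⁻¹ + B⁻¹)⁻¹).mul hE).mul_const A⁻¹).const_sub A⁻¹
  refine (hderiv.hasDerivWithinAt.congr_deriv ?_).congr_of_mem
    (fun s hs => inv_add_evolvedTilt hA hB hs) ht
  rw [hleft, hright, inv_add_evolvedTilt hA hB ht]
  simp only [add_mul, mul_sub, sub_mul, mul_neg, neg_mul, mul_assoc, Matrix.mul_nonsing_inv _ hAu,
    Matrix.nonsing_inv_mul _ hAu, Matrix.mul_nonsing_inv_cancel_left _ _ hAu,
    Matrix.nonsing_inv_mul_cancel_left _ _ hAu, mul_one]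
  abel

lemma tendsto_inv_add_evolvedTilt (hA : A.PosDef) (hB : B.PosDef) :
    Tendsto (fun t => (A + evolvedTilt A B t)⁻¹) atTop (𝓝 A⁻¹) := by
  have hE := tendsto_decay_atTop hA
  have hlim :=
    ((((hE.const_mul A⁻¹).mul_const (A⁻¹ + B⁻¹)⁻¹).mul hE).mul_const A⁻¹).const_sub A⁻¹
  simp only [mul_zero, zero_mul, sub_zero] at hlim
  exact hlim.congr' ((eventually_ge_atTop 0).mono fun t ht => (inv_add_evolvedTilt hA hB ht).symm)

end EvolvedTilt

section HeatFlow

variable {t : ℝ}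

lemma inv_inv_add_mul_inv_mul_conjTranspose (hA : A.PosDef) (hB : B.PosDef)
    (σ : Matrix (Fin n) (Fin n) ℝ) :
    (B⁻¹ + σ * A⁻¹ * σᴴ)⁻¹ = B - B * σ * (A + σᴴ * B * σ)⁻¹ * σᴴ * B := by
  have hA' := Matrix.nonsing_inv_nonsing_inv A (isUnit_det_of_posDef hA)
  have hB' := Matrix.nonsing_inv_nonsing_inv B (isUnit_det_of_posDef hB)
  have hM : (A + σᴴ * B * σ).PosDef :=
    hA.add_posSemidef (hB.posSemidef.conjTranspose_mul_mul_same σ)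
  rw [Matrix.add_mul_mul_inv_eq_sub _ _ _ _ hB.inv.isUnit hA.inv.isUnit
    (by rw [hA', hB']; exact hM.isUnit), hA', hB']

theorem integral_exp_neg_quad_add_app_gaussian (hA : A.PosDef) (hB : B.PosDef)
    (σ : Matrix (Fin n) (Fin n) ℝ) (m : Space n) :
    ∫ y, Real.exp (-(1 / 2) * quad B (m + app σ y)) ∂(gaussian A)
      = √A.det / √(A + σᴴ * B * σ).det
        * Real.exp (-(1 / 2) * quad (B⁻¹ + σ * A⁻¹ * σᴴ)⁻¹ m) := by
  have hcross : ∀ y, inner ℝ m (app B (app σ y)) = inner ℝ y (app (σᴴ * B) m) := fun y => by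
    rw [← app_mul, real_inner_comm, inner_app_left, Matrix.conjTranspose_mul, hB.isHermitian.eq]
  have hexp : ∀ y, Real.exp (-(1 / 2) * quad B (m + app σ y)) = Real.exp (-(1 / 2) * quad B m)
      * Real.exp (-(1 / 2) * quad (σᴴ * B * σ) y - inner ℝ y (app (σᴴ * B) m)) := fun y => by
    rw [← Real.exp_add, quad_map_add hB.isHermitian, hcross, quad_app]
    ring_nf
  simp_rw [hexp]
  rw [integral_const_mul, integral_exp_neg_quad_sub_inner_gaussian hA
    (hB.posSemidef.conjTranspose_mul_mul_same σ), mul_left_comm, ← Real.exp_add,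
    inv_inv_add_mul_inv_mul_conjTranspose hA hB, quad_sub, quad_app, Matrix.conjTranspose_mul,
    Matrix.conjTranspose_conjTranspose, hB.isHermitian.eq]
  simp only [mul_assoc]
  ring_nf

lemma det_add_mul_det_eq (hA : A.PosDef) (hB : B.PosDef) (ht : 0 ≤ t) :
    (A + B).det * A.det
      = (A + evolvedTilt A B t).det * (A + spread A t * B * spread A t).det := by
  have hAu := isUnit_det_of_posDef hA
  have hBu := isUnit_det_of_posDef hB
  set G := B⁻¹ + spread A t * A⁻¹ * spread A t with hG
  have hGu : IsUnit G.det := isUnit_det_of_posDef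
    (hB.inv.add_posSemidef (posSemidef_spread_mul_inv_mul_spread hA.posSemidef t))
  have hsum : G + decay A t * A⁻¹ * decay A t = B⁻¹ + A⁻¹ := by
    rw [hG, spread_mul_inv_mul_spread hA.posSemidef ht, add_assoc, sub_add_cancel]
  have hAB : (A + B).det = A.det * B.det * (B⁻¹ + A⁻¹).det := by
    simpa using det_add_mul_mul hAu hBu 1 1
  have hABt : (A + evolvedTilt A B t).det = A.det * G⁻¹.det * (B⁻¹ + A⁻¹).det := by
    rw [evolvedTilt_eq hA.posSemidef ht, det_add_mul_mul hAu (Matrix.isUnit_nonsing_inv_det _ hGu),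
      Matrix.nonsing_inv_nonsing_inv _ hGu, hsum]
  have hdet : G⁻¹.det * G.det = 1 := by
    rw [← Matrix.det_mul, Matrix.nonsing_inv_mul _ hGu, Matrix.det_one]
  rw [hAB, hABt, det_add_mul_mul hAu hBu, ← hG]
  linear_combination (-(A.det ^ 2 * B.det * (B⁻¹ + A⁻¹).det)) * hdet

theorem heatFlow_tiltDensity (hA : A.PosDef) (hB : B.PosDef) (ht : 0 ≤ t) :
    heatFlow A t (tiltDensity A B) = tiltDensity A (evolvedTilt A B t) := by
  have hBt := posDef_evolvedTilt hA.posSemidef hB ht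
  have hσ := (isHermitian_spread A t).eq
  have hM : (A + spread A t * B * spread A t).PosDef := by
    simpa only [hσ] using
      hA.add_posSemidef (hB.posSemidef.conjTranspose_mul_mul_same (spread A t))
  have := hA.det_pos
  have := hM.det_pos
  have hconst : √(A + B).det / √A.det * (√A.det / √(A + spread A t * B * spread A t).det)
      = √(A + evolvedTilt A B t).det / √A.det := by
    rw [div_mul_div_cancel₀ (by positivity), div_eq_div_iff (by positivity) (by positivity),
      ← Real.sqrt_mul (hA.add hB).det_pos.le, ← Real.sqrt_mul (hA.add hBt).det_pos.le,
      det_add_mul_det_eq hA hB ht]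
  ext x
  calc heatFlow A t (tiltDensity A B) x
      = √(A + B).det / √A.det * ∫ y, Real.exp
          (-(1 / 2) * quad B (app (decay A t) x + app (spread A t) y)) ∂(gaussian A) := by
        rw [← integral_const_mul]
        exact integral_congr_ae (Eventually.of_forall fun y => tiltDensity_eq hA hB.posSemidef _)
    _ = √(A + evolvedTilt A B t).det / √A.det
          * Real.exp (-(1 / 2) * quad (evolvedTilt A B t) x) := by
        rw [integral_exp_neg_quad_add_app_gaussian hA hB, hσ, ← mul_assoc, hconst, quad_app,
          (isHermitian_decay hA.isHermitian t).eq, ← evolvedTilt_eq hA.posSemidef ht]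
    _ = tiltDensity A (evolvedTilt A B t) x := (tiltDensity_eq hA hBt.posSemidef x).symm

lemma gradient_log_tiltDensity (hA : A.PosDef) (hB : B.PosSemidef) (x : Space n) :
    gradient (fun z => Real.log (tiltDensity A B z)) x = -app B x := by
  have := hA.det_pos
  have := (hA.add_posSemidef hB).det_pos
  have hlog : (fun z => Real.log (tiltDensity A B z))
      = fun z => Real.log (√(A + B).det / √A.det) + -(1 / 2 * quad B z) := by
    ext z
    rw [tiltDensity_eq hA hB, Real.log_mul (by positivity) (Real.exp_pos _).ne', Real.log_exp,
      neg_mul]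
  rw [hlog]
  refine HasGradientAt.gradient ?_
  rw [hasGradientAt_iff_hasFDerivAt, map_neg]
  exact (hasGradientAt_half_quad hB.isHermitian x).hasFDerivAt.neg.const_add _

lemma velocity_tiltDensity (hA : A.PosDef) (hB : B.PosDef) (ht : 0 ≤ t) :
    velocity A (tiltDensity A B) t = app (evolvedTilt A B t) := by
  ext1 x
  rw [velocity, heatFlow_tiltDensity hA hB ht,
    gradient_log_tiltDensity hA (posDef_evolvedTilt hA.posSemidef hB ht).posSemidef, neg_neg]

end HeatFlow

section KimMilmanMap

variable {Φ Ψ : ℝ → Matrix (Fin n) (Fin n) ℝ} {T : Matrix (Fin n) (Fin n) ℝ} {t : ℝ}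

lemma norm_inv_propagator_evolvedTilt_le (hA : A.PosSemidef) (hB : B.PosDef)
    (h : IsPropagator (evolvedTilt A B) Φ Ψ) (ht : 0 ≤ t) : ‖Ψ t‖ ≤ 1 := by
  simpa using h.norm_inv_le (c := 0) (fun s hs x => by
    simpa using quad_nonneg (posDef_evolvedTilt hA hB hs).posSemidef x) ht

theorem exists_isPropagator_evolvedTilt (hA : A.PosDef) (hB : B.PosDef) :
    ∃ Φ Ψ T, IsPropagator (evolvedTilt A B) Φ Ψ ∧ Tendsto Ψ atTop (𝓝 T) := by
  obtain ⟨Φ, Ψ, h⟩ := exists_isPropagator (continuousOn_evolvedTilt hA.posSemidef hB)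
  obtain ⟨T, hT⟩ := h.exists_tendsto_inv
    (fun t ht => norm_inv_propagator_evolvedTilt_le hA.posSemidef hB h ht)
    (integrableOn_evolvedTilt hA hB)
  exact ⟨Φ, Ψ, T, h, hT⟩

theorem isKimMilmanMap_tiltDensity_iff (hA : A.PosDef) (hB : B.PosDef)
    (h : IsPropagator (evolvedTilt A B) Φ Ψ) (hT : Tendsto Ψ atTop (𝓝 T))
    (U : Space n → Space n) : IsKimMilmanMap A (tiltDensity A B) U ↔ U = app T :=
  h.isKimMilmanMap_iff (continuousOn_evolvedTilt hA.posSemidef hB)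
    (fun _ ht => velocity_tiltDensity hA hB ht) hT U

lemma norm_limit_propagator_le (hA : A.PosSemidef) (hB : B.PosDef)
    (h : IsPropagator (evolvedTilt A B) Φ Ψ) (hT : Tendsto Ψ atTop (𝓝 T)) : ‖T‖ ≤ 1 :=
  le_of_tendsto hT.norm ((eventually_ge_atTop 0).mono fun _ ht =>
    norm_inv_propagator_evolvedTilt_le hA hB h ht)

theorem limit_mul_inv_mul_conjTranspose (hA : A.PosDef) (hB : B.PosDef)
    (h : IsPropagator (evolvedTilt A B) Φ Ψ) (hT : Tendsto Ψ atTop (𝓝 T)) :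
    T * A⁻¹ * Tᴴ = (A + B)⁻¹ := by
  have hconst : ∀ t, 0 ≤ t → Ψ t * (A + evolvedTilt A B t)⁻¹ * star (Ψ t) = (A + B)⁻¹ :=
    fun t ht => by
      rw [h.inv_mul_mul_star_inv
        (fun t ht => hasDerivWithinAt_inv_add_evolvedTilt hA hB ht) ht,
        evolvedTilt_zero (isUnit_det_of_posDef hB)]
  refine tendsto_nhds_unique ((hT.mul (tendsto_inv_add_evolvedTilt hA hB)).mul hT.star)
    (tendsto_const_nhds.congr' ?_)
  filter_upwards [eventually_ge_atTop 0] with t ht using (hconst t ht).symm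

end KimMilmanMap

section Brenier

theorem exists_isBrenierMap_gaussian (hA : A.PosDef) (hB : B.PosDef) :
    ∃ T, IsBrenierMap (gaussian A) (gaussian B) T := by
  obtain ⟨L, hL, hLA⟩ := exists_posSemidef_mul_mul_eq hA.inv hB.inv.posSemidef
  exact ⟨app L, measurePreserving_app_gaussian hA hB (by rw [hL.isHermitian.eq, hLA]), _,
    convexOn_half_quad hL, Eventually.of_forall (hasGradientAt_half_quad hL.isHermitian)⟩

lemma add_inner_le_of_hasGradientAt {E : Type*} [NormedAddCommGroup E] [InnerProductSpace ℝ E]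
    [CompleteSpace E] {φ : E → ℝ} (hφ : ConvexOn ℝ Set.univ φ) {x g : E}
    (hg : HasGradientAt φ g x) (y : E) : φ x + inner ℝ g (y - x) ≤ φ y := by
  have hg' : HasFDerivAt φ (InnerProductSpace.toDual ℝ E g) (AffineMap.lineMap x y (0 : ℝ)) := by
    simpa using hg.hasFDerivAt
  have hderiv : HasDerivAt (φ ∘ fun s : ℝ => AffineMap.lineMap x y s) (inner ℝ g (y - x)) 0 :=
    hg'.comp_hasDerivAt (0 : ℝ) AffineMap.hasDerivAt_lineMap
  have hslope := (hφ.comp_affineMap (AffineMap.lineMap x y)).le_slope_of_hasDerivAt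
    (Set.mem_univ 0) (Set.mem_univ 1) zero_lt_one hderiv
  simp only [slope_def_field, Function.comp_apply, AffineMap.lineMap_apply_one,
    AffineMap.lineMap_apply_zero, sub_zero, div_one] at hslope
  linarith

lemma hasFDerivAt_of_forall_add_inner_le {E : Type*} [NormedAddCommGroup E]
    [InnerProductSpace ℝ E] {φ : E → ℝ} (L : E →L[ℝ] E)
    (h : ∀ x y, φ x + inner ℝ (L x) (y - x) ≤ φ y) (x : E) :
    HasFDerivAt φ (innerSL ℝ (L x)) x := by
  rw [hasFDerivAt_iff_isLittleO_nhds_zero]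
  refine (Asymptotics.IsBigO.of_bound ‖L‖ (Eventually.of_forall fun v => ?_)).trans_isLittleO
    (Asymptotics.isLittleO_norm_pow_id one_lt_two)
  have hlower := h x (x + v)
  have hupper := h (x + v) x
  rw [add_sub_cancel_left] at hlower
  rw [sub_add_cancel_left, map_add, inner_add_left, inner_neg_right, inner_neg_right] at hupper
  have hL : inner ℝ (L v) v ≤ ‖L‖ * ‖v‖ ^ 2 :=
    calc inner ℝ (L v) v ≤ ‖L v‖ * ‖v‖ := real_inner_le_norm _ _
      _ ≤ ‖L‖ * ‖v‖ * ‖v‖ := by gcongr; exact L.le_opNorm v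
      _ = ‖L‖ * ‖v‖ ^ 2 := by ring
  rw [innerSL_apply_apply, Real.norm_eq_abs, Real.norm_eq_abs, abs_of_nonneg (by linarith),
    abs_of_nonneg (by positivity)]
  linarith

lemma isSymmetric_of_forall_add_inner_le {E : Type*} [NormedAddCommGroup E]
    [InnerProductSpace ℝ E] {φ : E → ℝ} (L : E →L[ℝ] E)
    (h : ∀ x y, φ x + inner ℝ (L x) (y - x) ≤ φ y) : (L : E →ₗ[ℝ] E).IsSymmetric := fun v w => by
  have hsymm : inner ℝ (L v) w = inner ℝ (L w) v :=
    second_derivative_symmetric (x := 0) (hasFDerivAt_of_forall_add_inner_le L h)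
      ((innerSL ℝ).comp L).hasFDerivAt v w
  exact hsymm.trans (real_inner_comm _ _)

theorem isHermitian_of_ae_hasGradientAt {φ : Space n → ℝ} (hφ : ConvexOn ℝ Set.univ φ)
    (h : ∀ᵐ x, HasGradientAt φ (app M x) x) : M.IsHermitian := by
  have hcont : Continuous φ := continuousOn_univ.1 (hφ.continuousOn isOpen_univ)
  have hsub : ∀ x y, φ x + inner ℝ (app M x) (y - x) ≤ φ y := fun x y => by
    have hclosed : IsClosed {x | φ x + inner ℝ (app M x) (y - x) ≤ φ y} :=
      isClosed_le (hcont.add ((continuous_app M).inner (continuous_const.sub continuous_id)))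
        continuous_const
    have hdense : Dense {x | φ x + inner ℝ (app M x) (y - x) ≤ φ y} :=
      Measure.dense_of_ae (h.mono fun x hx => add_inner_le_of_hasGradientAt hφ hx y)
    exact hclosed.closure_eq.subset (hdense x)
  have hsymm : ∀ x y, inner ℝ (app M x) y = inner ℝ x (app M y) :=
    isSymmetric_of_forall_add_inner_le (appCLM M) hsub
  refine appCLM_injective (ContinuousLinearMap.ext fun y => ext_inner_left ℝ fun x => ?_)
  rw [appCLM_apply, appCLM_apply, ← inner_app_left, hsymm]

end Brenier

section Comparison

lemma eq_zero_of_mul_mul_eq_self {R : Type*} [NormedRing R] {T X : R} (hT : ‖T‖ < 1)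
    (h : T * X * T = X) : X = 0 := by
  have hX : ‖X‖ ≤ ‖T‖ * ‖T‖ * ‖X‖ :=
    calc ‖X‖ = ‖T * X * T‖ := by rw [h]
      _ ≤ ‖T‖ * ‖X‖ * ‖T‖ := norm_mul₃_le
      _ = ‖T‖ * ‖T‖ * ‖X‖ := by ring
  have hTT : ‖T‖ * ‖T‖ < 1 := mul_lt_one_of_nonneg_of_lt_one_left (norm_nonneg T) hT hT.le
  refine norm_le_zero_iff.1 ?_
  nlinarith [norm_nonneg X]

lemma mul_lie_mul_eq_lie {R : Type*} [Ring R] {A B T : R} (hTB : Commute T B)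
    (h : T * (A + B) * T = A) : T * ⁅A, B⁆ * T = ⁅A, B⁆ :=
  calc T * ⁅A, B⁆ * T = T * (A + B) * (B * T) - (T * B) * (A + B) * T := by
        rw [Ring.lie_def]; noncomm_ring
    _ = T * (A + B) * (T * B) - (B * T) * (A + B) * T := by rw [hTB.eq]
    _ = (T * (A + B) * T) * B - B * (T * (A + B) * T) := by noncomm_ring
    _ = ⁅A, B⁆ := by rw [h, Ring.lie_def]

lemma isSelfAdjoint_of_hasDerivWithinAt {E : Type*} [NormedAddCommGroup E] [NormedSpace ℝ E]
    [StarAddMonoid E] [ContinuousStar E] [StarModule ℝ E] {f : ℝ → E} {f' : E} {s : Set ℝ} {x : ℝ}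
    (hs : UniqueDiffWithinAt ℝ s x) (hx : x ∈ s) (hf : HasDerivWithinAt f f' s x)
    (hself : ∀ y ∈ s, IsSelfAdjoint (f y)) : IsSelfAdjoint f' :=
  hs.eq_deriv s (hf.star.congr (fun y hy => (hself y hy).symm) (hself x hx).symm) hf

variable {T : Matrix (Fin n) (Fin n) ℝ}

lemma norm_eq_norm_eigenvalues (hT : T.IsHermitian) : ‖T‖ = ‖hT.eigenvalues‖ := by
  conv_lhs => rw [hT.spectral_theorem, Unitary.conjStarAlgAut_apply, ← Unitary.coe_star]
  rw [CStarRing.norm_mul_coe_unitary, CStarRing.norm_coe_unitary_mul, Matrix.l2_opNorm_diagonal]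
  rfl

lemma norm_lt_one_of_mul_add_mul_eq (hA : A.PosSemidef) (hB : B.PosDef) (hT : T.IsHermitian)
    (h : T * (A + B) * T = A) : ‖T‖ < 1 := by
  rw [norm_eq_norm_eigenvalues hT, pi_norm_lt_iff one_pos]
  intro j
  set e := hT.eigenvectorBasis j
  have hTe : app T e = hT.eigenvalues j • e :=
    WithLp.ofLp_injective 2 (hT.mulVec_eigenvectorBasis j)
  have hquad : hT.eigenvalues j ^ 2 * (quad A e + quad B e) = quad A e := by
    rw [← quad_add, ← quad_smul, ← hTe, quad_app, hT.eq, h]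
  have hAe := quad_nonneg hA e
  have hBe := quad_pos hB (hT.eigenvectorBasis.orthonormal.ne_zero j)
  rw [Real.norm_eq_abs, ← sq_lt_one_iff_abs_lt_one]
  by_contra! hge
  nlinarith

theorem commute_of_isHermitian_transport (hA : A.PosDef) (hB : B.PosDef) (hT : T.IsHermitian)
    (hBT : (B * T).IsHermitian) (hTA : T * A⁻¹ * T = (A + B)⁻¹) : Commute A B := by
  have hTAB : T * (A + B) * T = A := mul_mul_eq_of_mul_inv_mul_eq_inv (isUnit_det_of_posDef hA)
    (isUnit_det_of_posDef (hA.add hB)) hTA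
  have hTB : Commute T B := by
    rw [Commute, SemiconjBy, ← hBT.eq, Matrix.conjTranspose_mul, hT.eq, hB.isHermitian.eq]
  exact commute_iff_lie_eq.2 (eq_zero_of_mul_mul_eq_self
    (norm_lt_one_of_mul_add_mul_eq hA.posSemidef hB hT hTAB) (mul_lie_mul_eq_lie hTB hTAB))

variable {Φ Ψ : ℝ → Matrix (Fin n) (Fin n) ℝ} {t : ℝ}

lemma isHermitian_limit_of_not_mapsDiffer (hA : A.PosDef) (hB : B.PosDef)
    (h : IsPropagator (evolvedTilt A B) Φ Ψ) (hT : Tendsto Ψ atTop (𝓝 T))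
    (hdiff : ¬ MapsDiffer A B) : T.IsHermitian := by
  simp only [MapsDiffer, not_forall, not_not] at hdiff
  obtain ⟨U, U', hU, hU', hUU'⟩ := hdiff
  obtain ⟨φ, hφ, hgrad⟩ := hU'.gradient_convex
  rw [(isKimMilmanMap_tiltDensity_iff hA hB h hT U).1 hU] at hUU'
  refine isHermitian_of_ae_hasGradientAt hφ
    ((volume_absolutelyContinuous_gaussian hA).ae_le ?_)
  filter_upwards [hgrad, hUU'] with x hx hx'
  rwa [hx']

lemma isHermitian_propagator_mul_limit (hA : A.PosDef) (hB : B.PosDef)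
    (h : IsPropagator (evolvedTilt A B) Φ Ψ) (hT : Tendsto Ψ atTop (𝓝 T)) (ht : 0 ≤ t)
    (hdiff : ¬ MapsDiffer A (evolvedTilt A B t)) : (Φ t * T).IsHermitian := by
  have hshift := h.shift ht
  simp only [← evolvedTilt_evolvedTilt hA.posSemidef hB ht] at hshift
  exact isHermitian_limit_of_not_mapsDiffer hA (posDef_evolvedTilt hA.posSemidef hB ht) hshift
    ((hT.comp (tendsto_atTop_add_const_left _ t tendsto_id)).const_mul (Φ t)) hdiff

lemma nonCommutingPair_evolvedTilt (h : NonCommutingPair A B) (ht : 0 ≤ t) :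
    NonCommutingPair A (evolvedTilt A B t) :=
  ⟨h.1, posDef_evolvedTilt h.1.posSemidef h.2.1 ht,
    fun hcomm => h.2.2 (commute_of_commute_evolvedTilt h.1.posSemidef h.2.1 ht hcomm).eq⟩

theorem exists_mapsDiffer_evolvedTilt (h : NonCommutingPair A B) :
    ∃ t, 0 ≤ t ∧ MapsDiffer A (evolvedTilt A B t) := by
  obtain ⟨hA, hB, hAB⟩ := h
  obtain ⟨Φ, Ψ, T, hΦ, hT⟩ := exists_isPropagator_evolvedTilt hA hB
  by_contra! hdiff
  have hsymm : ∀ s, 0 ≤ s → (Φ s * T).IsHermitian := fun s hs =>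
    isHermitian_propagator_mul_limit hA hB hΦ hT hs (hdiff s hs)
  have hTsymm : T.IsHermitian := by simpa [hΦ.zero] using hsymm 0 le_rfl
  have hderiv : HasDerivWithinAt (fun s => Φ s * T) (B * T) (Set.Ici 0) 0 := by
    simpa [hΦ.zero, evolvedTilt_zero (isUnit_det_of_posDef hB)] using
      (hΦ.hasDerivWithinAt 0 le_rfl).mul_const T
  have hBT : (B * T).IsHermitian := isSelfAdjoint_of_hasDerivWithinAt
    (uniqueDiffOn_Ici (0 : ℝ) 0 Set.self_mem_Ici) Set.self_mem_Ici hderiv hsymm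
  have hTA := limit_mul_inv_mul_conjTranspose hA hB hΦ hT
  rw [hTsymm.eq] at hTA
  exact hAB (commute_of_isHermitian_transport hA hB hTsymm hBT hTA).eq

lemma exists_nonCommutingPair (hn : 2 ≤ n) :
    ∃ A B : Matrix (Fin n) (Fin n) ℝ, NonCommutingPair A B := by
  let i : Fin n := ⟨0, by omega⟩
  let j : Fin n := ⟨1, by omega⟩
  have hij : i ≠ j := by simp [i, j]
  let u : Fin n → ℝ := Pi.single i 1
  let v : Fin n → ℝ := Pi.single i 1 + Pi.single j 1
  set P := Matrix.vecMulVec u (star u)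
  set Q := Matrix.vecMulVec v (star v)
  refine ⟨1 + P, 1 + Q, Matrix.PosDef.one.add_posSemidef (Matrix.posSemidef_vecMulVec_self_star u),
    Matrix.PosDef.one.add_posSemidef (Matrix.posSemidef_vecMulVec_self_star v), fun h => ?_⟩
  have hPQ : P * Q = Q * P := by
    have hadd : (1 + P) * (1 + Q) - (1 + Q) * (1 + P) = P * Q - Q * P := by noncomm_ring
    rw [← sub_eq_zero, ← hadd, h, sub_self]
  have hentry := congrFun (congrFun hPQ i) j
  simp [P, Q, Matrix.vecMulVec_mul_vecMulVec, Matrix.vecMulVec_apply, u, v, hij, hij.symm]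
    at hentry

end Comparison

end KimMilman

end

open KimMilman

theorem mainTheorem1 (n : ℕ) :
    -- both maps are well defined for all pairs of symmetric positive definite matrices
    (∀ A B : Matrix (Fin n) (Fin n) ℝ, A.PosDef → B.PosDef →
      (∃! T, KimMilman.IsKimMilmanMap A (KimMilman.tiltDensity A B) T) ∧
      (∀ T, KimMilman.IsKimMilmanMap A (KimMilman.tiltDensity A B) T →
        LipschitzWith 1 T ∧
        MeasurePreserving T (KimMilman.gaussian A)
          (KimMilman.target A (KimMilman.tiltDensity A B))) ∧
      (∃ T, KimMilman.IsBrenierMap (KimMilman.gaussian A)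
        (KimMilman.target A (KimMilman.tiltDensity A B)) T)) ∧
    -- for every non-commuting pair, the maps differ for some measure along the heat flow
    (∀ A B : Matrix (Fin n) (Fin n) ℝ, KimMilman.NonCommutingPair A B →
      ∃ t : ℝ, 0 ≤ t ∧ ∃ B' : Matrix (Fin n) (Fin n) ℝ, KimMilman.NonCommutingPair A B' ∧
        KimMilman.heatFlow A t (KimMilman.tiltDensity A B) = KimMilman.tiltDensity A B' ∧
        KimMilman.MapsDiffer A B') ∧
    -- hence in every dimension at least two there is a non-commuting pair for which they differ
    (2 ≤ n → ∃ A B : Matrix (Fin n) (Fin n) ℝ,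
      KimMilman.NonCommutingPair A B ∧ KimMilman.MapsDiffer A B) := by
  refine ⟨fun A B hA hB => ?_, fun A B h => ?_, fun hn => ?_⟩
  · obtain ⟨Φ, Ψ, T, h, hT⟩ := exists_isPropagator_evolvedTilt hA hB
    simp only [isKimMilmanMap_tiltDensity_iff hA hB h hT, existsUnique_eq, forall_eq,
      target_tiltDensity hA hB.posSemidef, true_and]
    exact ⟨⟨lipschitzWith_app (norm_limit_propagator_le hA.posSemidef hB h hT),
      measurePreserving_app_gaussian hA (hA.add hB) (limit_mul_inv_mul_conjTranspose hA hB h hT)⟩,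
      exists_isBrenierMap_gaussian hA (hA.add hB)⟩
  · obtain ⟨t, ht, hdiff⟩ := exists_mapsDiffer_evolvedTilt h
    exact ⟨t, ht, evolvedTilt A B t, nonCommutingPair_evolvedTilt h ht,
      heatFlow_tiltDensity h.1 h.2.1 ht, hdiff⟩
  · obtain ⟨A, B, h⟩ := exists_nonCommutingPair hn
    obtain ⟨t, ht, hdiff⟩ := exists_mapsDiffer_evolvedTilt h
    exact ⟨A, evolvedTilt A B t, nonCommutingPair_evolvedTilt h ht, hdiff⟩
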